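/- Let $d\ge 0$ and let $Q\subset\mathbb R^d$ be open (the case of physical interest is $d=3$), with coordinates $z=(q,p)$ on $T^*Q=Q\times\mathbb R^d$ and $d\mu=d^dq\,d^dp$. **Setting.** Let $\mathfrak g$ be the space of smooth Hamiltonian vector fields $X_h=\nabla_ph\cdot\partial_q-\nabla_qh\cdot\partial_p$ on $T^*Q$, and let $\mathfrak g^*$ be the space of smooth compactly supported one-forms $\Pi_{id}=\Pi_q\cdot dq+\Pi_p\cdot dp$ on $T^*Q$, paired with $\mathfrak g$ by $\langle\Pi_{id},U\rangle=\int\Pi_{id}(U)\,d\mu$. Let $\mathfrak TQ$ be the space of families $\mathbb X=\bigoplus_{n\ge0}\mathbb X^n$ of smooth symmetric contravariant tensor fields on $Q$ for which $H_{\mathbb X}=\sum_nH_{\mathbb X^n}$, $H_{\mathbb X^n}=\theta^n(\mathbb X^n)=p_{i_1}\cdots p_{i_n}\mathbb X^{i_1\cdots i_n}(q)$, converges normally in $C^\infty(T^*Q)$ (e.g. finite sums), where $\theta=p\cdot dq$. The Schouten concomitant $[\mathbb X,\mathbb Y]_{SC}=\bigoplus_{n,m}[\mathbb X^n,\mathbb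 Y^m]_{SC}$ has as $[\mathbb X^n,\mathbb Y^m]_{SC}$ the symmetrization of $$n\,\mathbb X^{i_{m+1}\cdots i_{m+n-1}l}\,\partial_{q^l}\mathbb Y^{i_1\cdots i_m}-m\,\mathbb Y^{i_{n+1}\cdots i_{n+m-1}l}\,\partial_{q^l}\mathbb X^{i_1\cdots i_n}.$$ Let $\mathfrak T^*Q$ be the space of families $\mathbb A=(\mathbb A_n)_{n\ge0}$ of smooth symmetric covariant tensor fields on $Q$ with support in a common compact subset of $Q$ and components bounded by $CR^n$ for some $C,R$; the pairing is $\langle\mathbb A,\mathbb X\rangle=\sum_n\int_Q\mathbb A_{i_1\cdots i_n}\mathbb X^{i_1\cdots i_n}\,d^dq$. The generalized complete cotangent lift is $\mathbb X^{c*}=\sum_nX_{H_{\mathbb X^n}}$. Functional derivatives are taken in $\mathfrak g$ and in $\mathfrak TQ$: $\frac{d}{d\varepsilon}\big|_0K(\Pi+\varepsilon\Pi')=\langle\Pi',\delta K/\delta\Pi\rangle$ for all $\Pi'\in\mathfrak g^*$, and $\frac{d}{d\varepsilon}\big|_0F(\mathbb A+\varepsilon\mathbb B)=\langle\mathbb B,\delta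 F/\delta\mathbb A\rangle$ for all $\mathbb B\in\mathfrak T^*Q$. For a sign $\sigma\in\{1,-1\}$ let $$\{K,H\}^\sigma_{LP}(\Pi)=\sigma\int\Pi\cdot\Big[\tfrac{\delta K}{\delta\Pi},\tfrac{\delta H}{\delta\Pi}\Big]_{JL}d\mu,\qquad\{F,G\}^\sigma_{KM}(\mathbb A)=\sigma\Big\langle\mathbb A,\Big[\tfrac{\delta F}{\delta\mathbb A},\tfrac{\delta G}{\delta\mathbb A}\Big]_{SC}\Big\rangle,$$ where $[U,V]_{JL}=U\cdot\nabla V-V\cdot\nabla U$ is the Jacobi–Lie bracket; these are the Lie–Poisson and the Kuperschmidt–Manin bracket. **Proposition.** For $\Pi_{id}\in\mathfrak g^*$ let $\Phi(\Pi_{id})=(\mathbb A_n)_{n\ge0}$ be its kinetic moments: $\mathbb A_n$ is the symmetrization of $$\int\theta^{n-1}\otimes\vartheta\;d^dp,\qquad\vartheta=\big(n\Pi_q+(\nabla_q\cdot\Pi_p)\,p\big)\cdot dq,$$ with $\mathbb A_0=\int\nabla_q\cdot\Pi_p\,d^dp$. 1. $\Phi$ maps $\mathfrak g^*$ to $\mathfrak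 T^*Q$ and is dual to $\mathbb X\mapsto\mathbb X^{c*}\in\mathfrak g$: $\langle\Phi(\Pi),\mathbb X\rangle=\langle\Pi,\mathbb X^{c*}\rangle$ (with convergence of the series) for all $\mathbb X\in\mathfrak TQ$, and $\Phi(\Pi)$ is the only element of $\mathfrak T^*Q$ with this property. Moreover $\Phi(\Pi+dk)=\Phi(\Pi)$ for every smooth compactly supported function $k$ on $T^*Q$. 2. For each $\sigma$, $\Phi$ is a momentum map: $\mathfrak TQ$ is closed under $[\cdot,\cdot]_{SC}$; $\mathbb X_{\mathfrak g^*}(\Pi)=\sigma\mathcal L_{\mathbb X^{c*}}\Pi$ is an action of the Lie algebra $(\mathfrak TQ,\sigma[\cdot,\cdot]_{SC})$ on $\mathfrak g^*$ by linear maps, i.e. $(\sigma[\mathbb X,\mathbb Y]_{SC})_{\mathfrak g^*}=\mathbb X_{\mathfrak g^*}\mathbb Y_{\mathfrak g^*}-\mathbb Y_{\mathfrak g^*}\mathbb X_{\mathfrak g^*}$; and $J_{\mathbb X}(\Pi)=\langle\Phi(\Pi),\mathbb X\rangle$ has functional derivative $\mathbb X^{c*}$ and satisfies $\frac{d}{d\varepsilon}\big|_0K(\Pi+\varepsilon\mathbb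 X_{\mathfrak g^*}(\Pi))=\{K,J_{\mathbb X}\}^\sigma_{LP}(\Pi)$ for every functional $K$ with a functional derivative in $\mathfrak g$ at $\Pi$. 3. For each $\sigma$, $\Phi$ is a Poisson map from $(\mathfrak g^*,\{\cdot,\cdot\}^\sigma_{LP})$ to $(\mathfrak T^*Q,\{\cdot,\cdot\}^\sigma_{KM})$: if $F,G:\mathfrak T^*Q\to\mathbb R$ have functional derivatives in $\mathfrak TQ$ at $\Phi(\Pi)$, then $F\circ\Phi$ and $G\circ\Phi$ have functional derivatives in $\mathfrak g$ at $\Pi$, and $$\{F\circ\Phi,G\circ\Phi\}^\sigma_{LP}(\Pi)=\{F,G\}^\sigma_{KM}(\Phi(\Pi)).$$ -/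

import Mathlib

open MeasureTheory Set
open scoped ContDiff

namespace KineticMoments

noncomputable section

/-- Phase space coordinates `z = (q, p)`; the cotangent bundle of `Q ⊆ ℝ^d` is `Q × ℝ^d`. -/
abbrev Phase (d : ℕ) : Type := (Fin d → ℝ) × (Fin d → ℝ)

/-- The cotangent bundle `T^*Q = Q × ℝ^d`. -/
def cotangent {d : ℕ} (Q : Set (Fin d → ℝ)) : Set (Phase d) := Q ×ˢ univ

/-- One-forms on phase space. The component along `dq^l` is `η z (Pi.single l 1, 0)`,
the component along `dp_l` is `η z (0, Pi.single l 1)`. -/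
abbrev OneForm (d : ℕ) : Type := Phase d → Phase d →L[ℝ] ℝ

/-- Sequences of tensor fields on `Q ⊆ ℝ^d`, the `n`-th one of order `n`, in components. -/
abbrev TensorFamily (d : ℕ) : Type := (n : ℕ) → (Fin d → ℝ) → (Fin n → Fin d) → ℝ

/-- Symmetrization of an array of tensor components. -/
def symmetrize {d n : ℕ} (T : (Fin n → Fin d) → ℝ) : (Fin n → Fin d) → ℝ :=
  fun i => ((n.factorial : ℕ) : ℝ)⁻¹ * ∑ τ : Equiv.Perm (Fin n), T (i ∘ τ)

/-! ### Hamiltonian vector fields and the momentum variables -/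

/-- The Hamiltonian vector field `∇_p h · ∂_q - ∇_q h · ∂_p`. -/
def hamiltonianField {d : ℕ} (h : Phase d → ℝ) : Phase d → Phase d := fun z =>
  (fun l => fderiv ℝ h z (0, Pi.single l 1), fun l => -fderiv ℝ h z (Pi.single l 1, 0))

/-- The Lie algebra `𝔤` of smooth (globally) Hamiltonian vector fields on `T^*Q`. -/
def IsHamiltonianField {d : ℕ} (Q : Set (Fin d → ℝ)) (U : Phase d → Phase d) : Prop :=
  ∃ h : Phase d → ℝ, ContDiffOn ℝ ∞ h (cotangent Q) ∧
    ∀ z ∈ cotangent Q, U z = hamiltonianField h z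

/-- The (regular) dual `𝔤^*`: smooth one-forms with compact support in `T^*Q`; the density is
the Liouville volume. -/
def IsMomentumForm {d : ℕ} (Q : Set (Fin d → ℝ)) (η : OneForm d) : Prop :=
  ContDiff ℝ ∞ η ∧ HasCompactSupport η ∧ tsupport η ⊆ cotangent Q

/-- The `L²` pairing `∫ ⟨η, U⟩ dμ` of one-forms and vector fields on `T^*Q`. -/
def phasePairing {d : ℕ} (Q : Set (Fin d → ℝ)) (η : OneForm d) (U : Phase d → Phase d) : ℝ :=
  ∫ z in cotangent Q, η z (U z)

/-- The Lie derivative of a one-form along a vector field. -/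
def lieDerivative {d : ℕ} (U : Phase d → Phase d) (η : OneForm d) : OneForm d :=
  fun z => fderiv ℝ η z (U z) + (η z).comp (fderiv ℝ U z)

/-- `U ∈ 𝔤` is the functional derivative `δK/δη` of the functional `K` on `𝔤^*` at `η`. -/
def IsPhaseDerivative {d : ℕ} (Q : Set (Fin d → ℝ)) (K : OneForm d → ℝ) (η : OneForm d)
    (U : Phase d → Phase d) : Prop :=
  IsHamiltonianField Q U ∧ ∀ ζ : OneForm d, IsMomentumForm Q ζ →
    HasDerivAt (fun ε : ℝ => K (η + ε • ζ)) (phasePairing Q ζ U) 0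

/-- The functional derivative `δK/δη` (arbitrary when there is none). -/
def phaseDerivative {d : ℕ} (Q : Set (Fin d → ℝ)) (K : OneForm d → ℝ) (η : OneForm d) :
    Phase d → Phase d :=
  Classical.epsilon (IsPhaseDerivative Q K η)

/-- The real number `1` or `-1` that belongs to a sign. -/
def sgn (σ : ℤˣ) : ℝ := ((σ : ℤ) : ℝ)

/-- The Lie-Poisson bracket on `𝔤^*`, where `𝔤` carries `σ` times the Jacobi-Lie bracket. -/
def liePoisson {d : ℕ} (Q : Set (Fin d → ℝ)) (σ : ℤˣ) (K H : OneForm d → ℝ) (η : OneForm d) : ℝ :=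
  sgn σ * phasePairing Q η
    (VectorField.lieBracket ℝ (phaseDerivative Q K η) (phaseDerivative Q H η))

/-! ### Symmetric contravariant tensor fields and the generalized complete cotangent lift -/

/-- The components `p_{i_1} ⋯ p_{i_n}` of the `n`-th tensor power of the canonical one-form
`θ = p · dq`. -/
def thetaPow {d : ℕ} (n : ℕ) (z : Phase d) (i : Fin n → Fin d) : ℝ := ∏ j, z.2 (i j)

/-- `H_{X^n} = θ^n(X^n)`. -/
def hamiltonian {d : ℕ} (X : TensorFamily d) (n : ℕ) : Phase d → ℝ :=
  fun z => ∑ i : Fin n → Fin d, thetaPow n z i * X n z.1 i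

/-- The space `𝔗Q` of sequences `X = ⊕ X^n` of smooth symmetric contravariant tensor fields on `Q`
for which the series `H_X = ∑ H_{X^n}` converges normally in `C^∞(T^*Q)` (always the case when only
finitely many `X^n` are nonzero). -/
def IsContravariant {d : ℕ} (Q : Set (Fin d → ℝ)) (X : TensorFamily d) : Prop :=
  (∀ n, ContDiffOn ℝ ∞ (X n) Q) ∧
  (∀ n, ∀ q ∈ Q, ∀ (i : Fin n → Fin d) (τ : Equiv.Perm (Fin n)), X n q (i ∘ τ) = X n q i) ∧
  (∀ K : Set (Phase d), IsCompact K → K ⊆ cotangent Q → ∀ k : ℕ, ∃ u : ℕ → ℝ, Summable u ∧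
    ∀ n, ∀ z ∈ K, ‖iteratedFDeriv ℝ k (hamiltonian X n) z‖ ≤ u n)

/-- The generalized complete cotangent lift `X^{c*} = ∑ (X^n)^{c*}`, `(X^n)^{c*} = X_{H_{X^n}}`. -/
def completeLift {d : ℕ} (X : TensorFamily d) : Phase d → Phase d :=
  fun z => ∑' n, hamiltonianField (hamiltonian X n) z

/-- The part
`∑_{n + m = k + 1} n X^{i_{m+1} ⋯ i_{m+n-1} l} ∂Y^{i_1 ⋯ i_m} / ∂q^l` (with `n ≥ 1`) of the Schouten
concomitant in order `k`, before symmetrization. In the sum below, `n = k - m + 1`. -/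
def schoutenHalf {d : ℕ} (X Y : TensorFamily d) (k : ℕ) (q : Fin d → ℝ) (i : Fin k → Fin d) : ℝ :=
  ∑ m : Fin (k + 1), (((k - (m : ℕ) + 1 : ℕ)) : ℝ) * ∑ l : Fin d,
    X (k - (m : ℕ) + 1) q
        (Fin.snoc (α := fun _ => Fin d) (fun j : Fin (k - (m : ℕ)) => i ⟨(m : ℕ) + j, by omega⟩) l)
      * fderiv ℝ (Y (m : ℕ)) q (Pi.single l 1) (fun j : Fin (m : ℕ) => i ⟨j, by omega⟩)

/-- The Schouten concomitant of symmetric contravariant tensor fields. -/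
def schouten {d : ℕ} (X Y : TensorFamily d) : TensorFamily d :=
  fun k q => symmetrize fun i => schoutenHalf X Y k q i - schoutenHalf Y X k q i

/-! ### Symmetric covariant tensor fields and the Kuperschmidt-Manin bracket -/

/-- The (regular) dual `𝔗^*Q` of `𝔗Q`: sequences of smooth symmetric covariant tensor fields on `Q`,
supported in a common compact subset of `Q` and of at most geometric growth in the order. -/
def IsCovariant {d : ℕ} (Q : Set (Fin d → ℝ)) (A : TensorFamily d) : Prop :=
  (∀ n, ContDiff ℝ ∞ (A n)) ∧
  (∀ n q (i : Fin n → Fin d) (τ : Equiv.Perm (Fin n)), A n q (i ∘ τ) = A n q i) ∧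
  (∃ K : Set (Fin d → ℝ), IsCompact K ∧ K ⊆ Q ∧ ∀ n, ∀ q ∉ K, A n q = 0) ∧
  (∃ C R : ℝ, ∀ n q i, |A n q i| ≤ C * R ^ n)

/-- `⟨A_n, X^n⟩ = ∫ A_{i_1 ⋯ i_n} X^{i_1 ⋯ i_n} dq`. -/
def pairingTerm {d : ℕ} (Q : Set (Fin d → ℝ)) (A X : TensorFamily d) (n : ℕ) : ℝ :=
  ∫ q in Q, ∑ i : Fin n → Fin d, A n q i * X n q i

/-- `⟨A, X⟩ = ∑ ⟨A_n, X^n⟩`. -/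
def tensorPairing {d : ℕ} (Q : Set (Fin d → ℝ)) (A X : TensorFamily d) : ℝ :=
  ∑' n, pairingTerm Q A X n

/-- `X ∈ 𝔗Q` is the functional derivative `δF/δA` of the functional `F` on `𝔗^*Q` at `A`. -/
def IsTensorDerivative {d : ℕ} (Q : Set (Fin d → ℝ)) (F : TensorFamily d → ℝ) (A : TensorFamily d)
    (X : TensorFamily d) : Prop :=
  IsContravariant Q X ∧ ∀ B : TensorFamily d, IsCovariant Q B →
    HasDerivAt (fun ε : ℝ => F (A + ε • B)) (tensorPairing Q B X) 0

/-- The functional derivative `δF/δA` (arbitrary when there is none). -/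
def tensorDerivative {d : ℕ} (Q : Set (Fin d → ℝ)) (F : TensorFamily d → ℝ) (A : TensorFamily d) :
    TensorFamily d :=
  Classical.epsilon (IsTensorDerivative Q F A)

/-- The Kuperschmidt-Manin bracket on `𝔗^*Q`, where `𝔗Q` carries `σ` times the Schouten
concomitant. -/
def kuperschmidtManin {d : ℕ} (Q : Set (Fin d → ℝ)) (σ : ℤˣ) (F G : TensorFamily d → ℝ)
    (A : TensorFamily d) : ℝ :=
  sgn σ * tensorPairing Q A (schouten (tensorDerivative Q F A) (tensorDerivative Q G A))

/-! ### Kinetic moments -/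

/-- The divergence `∇_q · Π_p`. -/
def divq {d : ℕ} (η : OneForm d) (z : Phase d) : ℝ :=
  ∑ l : Fin d, fderiv ℝ (fun w => η w (0, Pi.single l 1)) z (Pi.single l 1, 0)

/-- The components of `ϑ = (n Π_q + (∇_q · Π_p) p) · dq`. -/
def vartheta {d : ℕ} (η : OneForm d) (n : ℕ) (z : Phase d) (l : Fin d) : ℝ :=
  (n : ℝ) * η z (Pi.single l 1, 0) + divq η z * z.2 l

/-- The components of `θ^{n-1} ⊗ ϑ`. For `n = 0` one has `ϑ = (∇_q · Π_p) θ`, and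
`θ^{-1} ⊗ ϑ` stands for the function `∇_q · Π_p`. -/
def momentDensity {d : ℕ} (η : OneForm d) : (n : ℕ) → Phase d → (Fin n → Fin d) → ℝ
  | 0, z, _ => divq η z
  | n + 1, z, i => thetaPow n z (Fin.init i) * vartheta η (n + 1) z (i (Fin.last n))

/-- The kinetic moments `A_n = ∫ θ^{n-1} ⊗ ϑ d^dp`, as symmetric covariant tensor fields. -/
def kineticMoments {d : ℕ} (η : OneForm d) : TensorFamily d :=
  fun n q => symmetrize fun i => ∫ p : Fin d → ℝ, momentDensity η n (q, p) i

/-! ### Dual maps, momentum maps and Poisson maps -/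

/-- `Φ : 𝔤^* → 𝔗^*Q` is the map dual to the generalized complete cotangent lift
`𝔗Q → 𝔤`; it does not depend on the choice of a one-form modulo exact ones. -/
def IsDualMap {d : ℕ} (Q : Set (Fin d → ℝ)) (Φ : OneForm d → TensorFamily d) : Prop :=
  ∀ η : OneForm d, IsMomentumForm Q η →
    IsCovariant Q (Φ η) ∧
    (∀ X, IsContravariant Q X →
      IsHamiltonianField Q (completeLift X) ∧
      HasSum (pairingTerm Q (Φ η) X) (phasePairing Q η (completeLift X))) ∧
    (∀ A, IsCovariant Q A →
      (∀ X, IsContravariant Q X → tensorPairing Q A X = phasePairing Q η (completeLift X)) →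
      A = Φ η) ∧
    (∀ k : Phase d → ℝ, ContDiff ℝ ∞ k → HasCompactSupport k → tsupport k ⊆ cotangent Q →
      Φ (η + fderiv ℝ k) = Φ η)

/-- The infinitesimal (coadjoint) action of `𝔗Q` on `𝔤^*` through the complete cotangent lift. -/
def infinitesimalAction {d : ℕ} (σ : ℤˣ) (X : TensorFamily d) (η : OneForm d) : OneForm d :=
  sgn σ • lieDerivative (completeLift X) η

/-- `Φ` is a momentum map for the action of the Lie algebra `(𝔗Q, σ [ , ]_SC)` on the Poisson space
`𝔤^*`: the action is a Lie algebra action on `𝔤^*`, and its generators are the Hamiltonian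
vector fields of the functions `J_X(η) = ⟨Φ(η), X⟩`, that is `{K, J_X} = X_{𝔤^*}[K]`. -/
def IsMomentumMap {d : ℕ} (Q : Set (Fin d → ℝ)) (σ : ℤˣ) (Φ : OneForm d → TensorFamily d) : Prop :=
  (∀ X η, IsContravariant Q X → IsMomentumForm Q η →
    IsMomentumForm Q (infinitesimalAction σ X η)) ∧
  (∀ X Y η, IsContravariant Q X → IsContravariant Q Y → IsMomentumForm Q η →
    IsContravariant Q (schouten X Y) ∧
    infinitesimalAction σ (sgn σ • schouten X Y) η =
      infinitesimalAction σ X (infinitesimalAction σ Y η) -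
        infinitesimalAction σ Y (infinitesimalAction σ X η)) ∧
  (∀ X η, IsContravariant Q X → IsMomentumForm Q η →
    IsPhaseDerivative Q (fun ζ => tensorPairing Q (Φ ζ) X) η (completeLift X) ∧
    ∀ K : OneForm d → ℝ, (∃ U, IsPhaseDerivative Q K η U) →
      HasDerivAt (fun ε : ℝ => K (η + ε • infinitesimalAction σ X η))
        (liePoisson Q σ K (fun ζ => tensorPairing Q (Φ ζ) X) η) 0)

/-- `Φ` is a Poisson map from the Lie-Poisson bracket on `𝔤^*` to the Kuperschmidt-Manin bracket on
`𝔗^*Q`: functionals with functional derivatives in `𝔗Q` pull back to functionals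
with functional derivatives in `𝔤`, and `Φ^*{F, G} = {Φ^*F, Φ^*G}`. -/
def IsPoissonMap {d : ℕ} (Q : Set (Fin d → ℝ)) (σ : ℤˣ) (Φ : OneForm d → TensorFamily d) : Prop :=
  ∀ η : OneForm d, IsMomentumForm Q η → ∀ F G : TensorFamily d → ℝ,
    (∃ X, IsTensorDerivative Q F (Φ η) X) → (∃ Y, IsTensorDerivative Q G (Φ η) Y) →
    (∃ U, IsPhaseDerivative Q (F ∘ Φ) η U) ∧ (∃ V, IsPhaseDerivative Q (G ∘ Φ) η V) ∧
    liePoisson Q σ (F ∘ Φ) (G ∘ Φ) η = kuperschmidtManin Q σ F G (Φ η)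

end

end KineticMoments

open KineticMoments

/-! The statement is duality for a Lie algebra homomorphism. The lift `X ↦ X^{c*}` is a homomorphism
from the Schouten concomitant to the Jacobi-Lie bracket, and the kinetic moments are its dual map;
the momentum map and Poisson properties then follow formally.

Homomorphism: contracting with `θ^k`, which is symmetric, makes the symmetrization in the
concomitant invisible, and `n θ^{n-1}(X^n(·, l)) = ∂H_{X^n}/∂p_l`. So `H` turns the concomitant into
the canonical bracket `∇_p f · ∇_q g - ∇_q f · ∇_p g` (`totalHamiltonian_schouten`), whose
Hamiltonian field is the Jacobi-Lie bracket of the fields of `f` and `g`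
(`lieBracket_hamiltonianField`). Normal convergence justifies Cauchy products and termwise
derivatives.

Duality: integration by parts in `q` gives `∫ Π(X_h) = ∫ (Π_q · ∇_p h + (∇_q · Π_p) h)`
(`phasePairing_hamiltonianField`). For `h = H_{X^n}` the integrand is the contraction of `θ^{n-1} ⊗
ϑ` with `X^n`; integrating over the fibres first produces the moments, and dominated convergence
sums over `n`. Uniqueness comes from testing against tensor fields of a single order.

Brackets: Hamiltonian fields are divergence-free, so `∫ (L_V η)(U) = ∫ η([U, V])`
(`phasePairing_lieDerivative`). This identifies the generators of the action. Functional derivatives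
are unique on `T^*Q`, so the arbitrary choice in their definition does not affect the brackets
(`liePoisson_eq`). -/

namespace KineticMoments

/-! ### Normally convergent series of smooth functions -/

/-- The series `∑ f n` of smooth functions converges normally in `C^∞(s)`. -/
structure NormallySummableOn {E F : Type} [NormedAddCommGroup E] [NormedSpace ℝ E]
    [NormedAddCommGroup F] [NormedSpace ℝ F] (f : ℕ → E → F) (s : Set E) : Prop where
  contDiffOn : ∀ n, ContDiffOn ℝ ∞ (f n) s
  bound : ∀ K : Set E, IsCompact K → K ⊆ s → ∀ k : ℕ, ∃ u : ℕ → ℝ, Summable u ∧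
    ∀ n, ∀ z ∈ K, ‖iteratedFDeriv ℝ k (f n) z‖ ≤ u n

namespace NormallySummableOn

variable {E F G : Type} [NormedAddCommGroup E] [NormedSpace ℝ E] [NormedAddCommGroup F]
  [NormedSpace ℝ F] [NormedAddCommGroup G] [NormedSpace ℝ G] {f g : ℕ → E → F} {s : Set E}

theorem contDiffAt (hf : NormallySummableOn f s) (hs : IsOpen s) (n : ℕ) {z : E} (hz : z ∈ s) :
    ContDiffAt ℝ ∞ (f n) z :=
  (hf.contDiffOn n).contDiffAt (hs.mem_nhds hz)

theorem congr (hf : NormallySummableOn f s) (hs : IsOpen s) (h : ∀ n, EqOn (g n) (f n) s) :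
    NormallySummableOn g s := by
  refine ⟨fun n => (hf.contDiffOn n).congr (h n), fun K hK hKs k => ?_⟩
  obtain ⟨u, hu, hb⟩ := hf.bound K hK hKs k
  refine ⟨u, hu, fun n z hz => ?_⟩
  have : g n =ᶠ[nhds z] f n := (h n).eventuallyEq_of_mem (hs.mem_nhds (hKs hz))
  rw [(this.iteratedFDeriv ℝ k).eq_of_nhds]
  exact hb n z hz

theorem fderiv (hf : NormallySummableOn f s) (hs : IsOpen s) :
    NormallySummableOn (fun n => fderiv ℝ (f n)) s := by
  refine ⟨fun n => (hf.contDiffOn n).fderiv_of_isOpen hs (by simp), fun K hK hKs k => ?_⟩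
  obtain ⟨u, hu, hb⟩ := hf.bound K hK hKs (k + 1)
  exact ⟨u, hu, fun n z hz => norm_iteratedFDeriv_fderiv.trans_le (hb n z hz)⟩

theorem clm (hf : NormallySummableOn f s) (hs : IsOpen s) (L : F →L[ℝ] G) :
    NormallySummableOn (fun n z => L (f n z)) s := by
  refine ⟨fun n => L.contDiff.comp_contDiffOn (hf.contDiffOn n), fun K hK hKs k => ?_⟩
  obtain ⟨u, hu, hb⟩ := hf.bound K hK hKs k
  refine ⟨fun n => ‖L‖ * u n, hu.mul_left _, fun n z hz => ?_⟩
  refine (L.norm_iteratedFDeriv_comp_left (hf.contDiffAt hs n (hKs hz))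
    (mod_cast le_top)).trans ?_
  exact mul_le_mul_of_nonneg_left (hb n z hz) (norm_nonneg _)

theorem fderiv_apply (hf : NormallySummableOn f s) (hs : IsOpen s) (v : E) :
    NormallySummableOn (fun n z => _root_.fderiv ℝ (f n) z v) s :=
  (hf.fderiv hs).clm hs (ContinuousLinearMap.apply ℝ F v)

theorem shift (hf : NormallySummableOn f s) : NormallySummableOn (fun n => f (n + 1)) s := by
  refine ⟨fun n => hf.contDiffOn (n + 1), fun K hK hKs k => ?_⟩
  obtain ⟨u, hu, hb⟩ := hf.bound K hK hKs k
  exact ⟨fun n => u (n + 1), (summable_nat_add_iff 1).2 hu, fun n => hb (n + 1)⟩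

theorem sum {ι : Type} {t : Finset ι} {f : ι → ℕ → E → F} (hs : IsOpen s)
    (hf : ∀ i ∈ t, NormallySummableOn (f i) s) :
    NormallySummableOn (fun n z => ∑ i ∈ t, f i n z) s := by
  refine ⟨fun n => ContDiffOn.sum fun i hi => (hf i hi).contDiffOn n, fun K hK hKs k => ?_⟩
  choose! u hu hb using fun i (hi : i ∈ t) => (hf i hi).bound K hK hKs k
  refine ⟨fun n => ∑ i ∈ t, u i n, summable_sum hu, fun n z hz => ?_⟩
  have : (fun z => ∑ i ∈ t, f i n z) = ∑ i ∈ t, f i n := by ext; simp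
  rw [this, iteratedFDeriv_sum_apply fun i hi =>
    ((hf i hi).contDiffAt hs n (hKs hz)).of_le (mod_cast le_top)]
  exact norm_sum_le_of_le _ fun i hi => hb i hi n z hz

theorem sub (hf : NormallySummableOn f s) (hg : NormallySummableOn g s) (hs : IsOpen s) :
    NormallySummableOn (fun n z => f n z - g n z) s := by
  have h := sum (t := Finset.univ) (f := fun b : Bool => cond b f fun n z => -g n z) hs
    (by rintro (_ | _) -
        · exact hg.clm hs (-ContinuousLinearMap.id ℝ F)
        · exact hf)
  simpa [sub_eq_add_neg] using h

/-- By the Leibniz rule the derivatives of order `k` are dominated by binomial combinations of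
Cauchy products of the majorants of orders `j` and `k - j`. -/
theorem mul {f g : ℕ → E → ℝ} (hf : NormallySummableOn f s) (hg : NormallySummableOn g s)
    (hs : IsOpen s) :
    NormallySummableOn
      (fun n z => ∑ x ∈ Finset.HasAntidiagonal.antidiagonal n, f x.1 z * g x.2 z) s := by
  refine ⟨fun n => ContDiffOn.sum fun x _ => (hf.contDiffOn _).mul (hg.contDiffOn _),
    fun K hK hKs k => ?_⟩
  choose u hu hub using hf.bound K hK hKs
  choose v hv hvb using hg.bound K hK hKs
  -- Absolute values are needed because a majorant may be negative when `K` is empty.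
  refine ⟨fun n => ∑ j ∈ Finset.range (k + 1), (k.choose j : ℝ) *
    ∑ x ∈ Finset.HasAntidiagonal.antidiagonal n, ‖u j x.1‖ * ‖v (k - j) x.2‖, ?_, fun n z hz => ?_⟩
  · refine summable_sum fun j _ => Summable.mul_left _ ?_
    have hp : Summable fun x : ℕ × ℕ => ‖u j x.1‖ * ‖v (k - j) x.2‖ :=
      (hu j).norm.mul_of_nonneg (hv (k - j)).norm (fun _ => norm_nonneg _) fun _ => norm_nonneg _
    exact summable_sum_mul_antidiagonal_of_summable_mul (f := fun m => ‖u j m‖)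
      (g := fun m => ‖v (k - j) m‖) hp
  have e : (fun z => ∑ x ∈ Finset.HasAntidiagonal.antidiagonal n, f x.1 z * g x.2 z) =
      ∑ x ∈ Finset.HasAntidiagonal.antidiagonal n, fun z => f x.1 z * g x.2 z := by ext; simp
  have hfa (m : ℕ) : ContDiffAt ℝ k (f m) z :=
    (hf.contDiffAt hs m (hKs hz)).of_le (mod_cast le_top)
  have hga (m : ℕ) : ContDiffAt ℝ k (g m) z :=
    (hg.contDiffAt hs m (hKs hz)).of_le (mod_cast le_top)
  rw [e, iteratedFDeriv_sum_apply fun x _ => (hfa _).mul (hga _)]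
  simp_rw [Finset.mul_sum]
  rw [Finset.sum_comm]
  refine norm_sum_le_of_le _ fun x _ => ?_
  have key := norm_iteratedFDerivWithin_mul_le (s := s) (n := k)
    ((hf.contDiffOn x.1).of_le (mod_cast le_top) : ContDiffOn ℝ k (f x.1) s)
    ((hg.contDiffOn x.2).of_le (mod_cast le_top) : ContDiffOn ℝ k (g x.2) s)
    hs.uniqueDiffOn (hKs hz) le_rfl
  simp only [iteratedFDerivWithin_of_isOpen _ hs (hKs hz)] at key
  refine key.trans (Finset.sum_le_sum fun j _ => ?_)
  rw [mul_assoc]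
  gcongr
  · exact (hub j _ z hz).trans (le_abs_self _)
  · exact (hvb _ _ z hz).trans (le_abs_self _)

theorem summable_norm (hf : NormallySummableOn f s) {z : E} (hz : z ∈ s) :
    Summable fun n => ‖f n z‖ := by
  obtain ⟨u, hu, hb⟩ := hf.bound {z} isCompact_singleton (singleton_subset_iff.2 hz) 0
  exact hu.of_nonneg_of_le (fun _ => norm_nonneg _) fun n => by simpa using hb n z rfl

variable [CompleteSpace F]

theorem hasSum (hf : NormallySummableOn f s) {z : E} (hz : z ∈ s) :
    HasSum (fun n => f n z) (∑' n, f n z) :=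
  (hf.summable_norm hz).of_norm.hasSum

variable [FiniteDimensional ℝ E]

/-- A closed ball around `z` inside `s` is compact, so the first derivatives have a summable
majorant on it and termwise differentiation is allowed. -/
theorem hasFDerivAt_tsum (hf : NormallySummableOn f s) (hs : IsOpen s) {z : E} (hz : z ∈ s) :
    HasFDerivAt (fun y => ∑' n, f n y) (∑' n, _root_.fderiv ℝ (f n) z) z := by
  obtain ⟨r, hr, hrs⟩ := Metric.nhds_basis_closedBall.mem_iff.1 (hs.mem_nhds hz)
  have : ProperSpace E := FiniteDimensional.proper ℝ E
  obtain ⟨u, hu, hb⟩ := hf.bound _ (isCompact_closedBall z r) hrs 1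
  refine hasFDerivAt_tsum_of_isPreconnected hu Metric.isOpen_ball
    (convex_ball z r).isPreconnected (fun n y hy => ?_) (fun n y hy => ?_)
    (Metric.mem_ball_self hr) (hf.summable_norm hz).of_norm (Metric.mem_ball_self hr)
  · exact ((hf.contDiffAt hs n (hrs (Metric.ball_subset_closedBall hy))).differentiableAt
      (by simp)).hasFDerivAt
  · rw [← norm_iteratedFDeriv_one]
    exact hb n y (Metric.ball_subset_closedBall hy)

theorem contDiffOn_tsum (hf : NormallySummableOn f s) (hs : IsOpen s) :
    ContDiffOn ℝ ∞ (fun y => ∑' n, f n y) s := by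
  rw [contDiffOn_infty]
  intro k
  -- The derivative of the sum is again a normally convergent series, now with values in `E →L[ℝ]
  -- F`; hence the codomain must vary in the induction.
  induction k generalizing F with
  | zero =>
    exact contDiffOn_zero.2 fun z hz =>
      (hf.hasFDerivAt_tsum hs hz).continuousAt.continuousWithinAt
  | succ k ih =>
    rw [Nat.cast_succ, contDiffOn_succ_iff_fderiv_of_isOpen hs]
    refine ⟨fun z hz => (hf.hasFDerivAt_tsum hs hz).differentiableAt.differentiableWithinAt,
      by simp, ?_⟩
    exact (ih (hf.fderiv hs)).congr fun z hz => (hf.hasFDerivAt_tsum hs hz).fderiv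

theorem hasSum_fderiv_apply (hf : NormallySummableOn f s) (hs : IsOpen s) {z : E} (hz : z ∈ s)
    (v : E) : HasSum (fun n => _root_.fderiv ℝ (f n) z v)
      (_root_.fderiv ℝ (fun y => ∑' n, f n y) z v) := by
  rw [(hf.hasFDerivAt_tsum hs hz).fderiv]
  exact ((hf.fderiv hs).hasSum hz).mapL (ContinuousLinearMap.apply ℝ F v)

end NormallySummableOn

/-! ### Smooth functions with compact support -/

section CompactSupport

variable {E F : Type} [NormedAddCommGroup E] [NormedSpace ℝ E] [NormedAddCommGroup F]
  [NormedSpace ℝ F]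

/-- Hamiltonians and vector fields are controlled only over `Q`; this lets their products with forms
supported there count as globally smooth. -/
theorem contDiff_of_tsupport_subset {f : E → F} {s : Set E} (hs : IsOpen s)
    (hf : ContDiffOn ℝ ∞ f s) (h : tsupport f ⊆ s) : ContDiff ℝ ∞ f := by
  rw [contDiff_iff_contDiffAt]
  intro z
  by_cases hz : z ∈ s
  · exact hf.contDiffAt (hs.mem_nhds hz)
  · exact contDiffAt_const.congr_of_eventuallyEq
      (notMem_tsupport_iff_eventuallyEq.1 fun h' => hz (h h'))

theorem integral_fderiv_apply_eq_zero [FiniteDimensional ℝ E] [MeasurableSpace E] [BorelSpace E]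
    (μ : Measure E) [μ.IsAddHaarMeasure] {f : E → ℝ} (hf : ContDiff ℝ ∞ f)
    (hc : HasCompactSupport f) (v : E) : ∫ z, fderiv ℝ f z v ∂μ = 0 := by
  have hd : Continuous fun z => fderiv ℝ f z v :=
    (hf.continuous_fderiv (by simp)).clm_apply continuous_const
  -- Integration by parts against the constant function `1`.
  have h := integral_mul_fderiv_eq_neg_fderiv_mul_of_integrable (μ := μ) (v := v)
    (f := fun _ : E => (1 : ℝ)) (g := f) (by simp)
    (by simpa using hd.integrable_of_hasCompactSupport (hc.fderiv_apply ℝ v))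
    (by simpa using hf.continuous.integrable_of_hasCompactSupport hc)
    (fun _ _ => by fun_prop) (fun z _ => hf.differentiable (by simp) z)
  simpa using h

end CompactSupport

variable {d : ℕ} {Q : Set (Fin d → ℝ)}

theorem isOpen_cotangent (hQ : IsOpen Q) : IsOpen (cotangent Q) := hQ.prod isOpen_univ

theorem mem_cotangent {z : Phase d} : z ∈ cotangent Q ↔ z.1 ∈ Q := by simp [cotangent]

/-! ### Symmetrization -/

section Symmetrize

variable {n : ℕ}

theorem symmetrize_comp_perm (T : (Fin n → Fin d) → ℝ) (i : Fin n → Fin d)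
    (τ : Equiv.Perm (Fin n)) : symmetrize T (i ∘ τ) = symmetrize T i := by
  unfold symmetrize
  congr 1
  exact Fintype.sum_equiv (Equiv.mulLeft τ) _ _ fun ρ => by
    simp [Function.comp_assoc, Equiv.Perm.coe_mul]

/-- Reindexing moves each permutation onto `S`, which absorbs it. This removes the symmetrization
from the concomitant (with `S = θ^n`) and from the moments (with `S = X^n`). -/
theorem sum_mul_symmetrize {S : (Fin n → Fin d) → ℝ}
    (hS : ∀ i, ∀ τ : Equiv.Perm (Fin n), S (i ∘ τ) = S i) (T : (Fin n → Fin d) → ℝ) :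
    ∑ i, S i * symmetrize T i = ∑ i, S i * T i := by
  have h (τ : Equiv.Perm (Fin n)) : ∑ i, S i * T (i ∘ τ) = ∑ i, S i * T i :=
    Fintype.sum_equiv (τ.symm.arrowCongr (Equiv.refl _)) _ _ fun i => by
      have : τ.symm.arrowCongr (Equiv.refl (Fin d)) i = i ∘ τ := by ext; simp
      rw [this, hS]
  have hn : ((n.factorial : ℕ) : ℝ) ≠ 0 := by exact_mod_cast n.factorial_ne_zero
  calc ∑ i, S i * symmetrize T i
      = ((n.factorial : ℕ) : ℝ)⁻¹ * ∑ τ : Equiv.Perm (Fin n), ∑ i, S i * T (i ∘ τ) := by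
        rw [Finset.sum_comm, Finset.mul_sum]
        refine Finset.sum_congr rfl fun i _ => ?_
        rw [symmetrize, ← Finset.mul_sum]
        ring
    _ = ∑ i, S i * T i := by simp [h, Fintype.card_perm, hn]

theorem thetaPow_comp_perm (z : Phase d) (i : Fin n → Fin d) (τ : Equiv.Perm (Fin n)) :
    thetaPow n z (i ∘ τ) = thetaPow n z i :=
  Equiv.prod_comp τ fun j => z.2 (i j)

theorem apply_insertNth_of_symmetric {T : (Fin (n + 1) → Fin d) → ℝ}
    (hT : ∀ i, ∀ τ : Equiv.Perm (Fin (n + 1)), T (i ∘ τ) = T i) (j : Fin (n + 1)) (l : Fin d)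
    (i : Fin n → Fin d) :
    T (Fin.insertNth (α := fun _ => Fin d) j l i) = T (Fin.snoc (α := fun _ => Fin d) i l) := by
  -- This permutation sends the last slot to `j` and the other slots, in order, to the slots
  -- different from `j`.
  rw [← hT _ ((finSuccEquiv' (Fin.last n)).trans (finSuccEquiv' j).symm)]
  congr 1
  ext k
  refine Fin.lastCases ?_ (fun k => ?_) k
  · simp
  · rw [← Fin.succAbove_last_apply]
    simp [-Fin.succAbove_last]
    simp

end Symmetrize

/-! ### Derivatives of the Hamiltonians -/

theorem contDiff_thetaPow (n : ℕ) (i : Fin n → Fin d) :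
    ContDiff ℝ ∞ fun z : Phase d => thetaPow n z i := by
  unfold thetaPow
  exact contDiff_prod fun j _ => by fun_prop

theorem hasFDerivAt_thetaPow (n : ℕ) (i : Fin n → Fin d) (z : Phase d) :
    HasFDerivAt (fun z : Phase d => thetaPow n z i)
      (∑ j, (∏ k ∈ Finset.univ.erase j, z.2 (i k)) •
        (ContinuousLinearMap.proj (R := ℝ) (φ := fun _ : Fin d => ℝ) (i j)).comp
          (ContinuousLinearMap.snd ℝ (Fin d → ℝ) (Fin d → ℝ))) z := by
  unfold thetaPow
  exact HasFDerivAt.finsetProd fun j _ =>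
    ((ContinuousLinearMap.proj (R := ℝ) (φ := fun _ : Fin d => ℝ) (i j)).comp
      (ContinuousLinearMap.snd ℝ (Fin d → ℝ) (Fin d → ℝ))).hasFDerivAt

theorem contDiffOn_hamiltonian {X : TensorFamily d} {n : ℕ} (hX : ContDiffOn ℝ ∞ (X n) Q) :
    ContDiffOn ℝ ∞ (hamiltonian X n) (cotangent Q) := by
  refine ContDiffOn.sum fun i _ => (contDiff_thetaPow n i).contDiffOn.mul ?_
  exact (contDiffOn_pi.1 hX i).comp contDiff_fst.contDiffOn fun z hz => mem_cotangent.1 hz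

theorem IsContravariant.normallySummableOn {X : TensorFamily d} (hX : IsContravariant Q X) :
    NormallySummableOn (hamiltonian X) (cotangent Q) :=
  ⟨fun n => contDiffOn_hamiltonian (hX.1 n), hX.2.2⟩

theorem fderiv_hamiltonian {X : TensorFamily d} {n : ℕ} (hQ : IsOpen Q)
    (hX : ContDiffOn ℝ ∞ (X n) Q) {z : Phase d} (hz : z.1 ∈ Q) (v : Phase d) :
    fderiv ℝ (hamiltonian X n) z v =
      ∑ i, (thetaPow n z i * fderiv ℝ (X n) z.1 v.1 i +
        X n z.1 i * ∑ j, (∏ k ∈ Finset.univ.erase j, z.2 (i k)) * v.2 (i j)) := by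
  have hd : HasFDerivAt (X n) (fderiv ℝ (X n) z.1) z.1 :=
    ((hX.contDiffAt (hQ.mem_nhds hz)).differentiableAt (by simp)).hasFDerivAt
  have h (i : Fin n → Fin d) := (hasFDerivAt_thetaPow n i z).mul
    ((hasFDerivAt_pi'.1 hd i).comp z hasFDerivAt_fst)
  have := HasFDerivAt.fun_sum (u := Finset.univ) fun i _ => h i
  have e : hamiltonian X n = fun z => ∑ i : Fin n → Fin d,
      ((fun z => thetaPow n z i) * ((fun x => X n x i) ∘ Prod.fst) : Phase d → ℝ) z := rfl
  rw [e, this.fderiv]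
  simp

theorem fderiv_hamiltonian_dq {X : TensorFamily d} {n : ℕ} (hQ : IsOpen Q)
    (hX : ContDiffOn ℝ ∞ (X n) Q) {z : Phase d} (hz : z.1 ∈ Q) (v : Fin d → ℝ) :
    fderiv ℝ (hamiltonian X n) z (v, 0) = ∑ i, thetaPow n z i * fderiv ℝ (X n) z.1 v i := by
  simp [fderiv_hamiltonian hQ hX hz]

theorem fderiv_hamiltonian_dp_zero {X : TensorFamily d} (hQ : IsOpen Q)
    (hX : ContDiffOn ℝ ∞ (X 0) Q) {z : Phase d} (hz : z.1 ∈ Q) (v : Fin d → ℝ) :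
    fderiv ℝ (hamiltonian X 0) z (0, v) = 0 := by
  simp [fderiv_hamiltonian hQ hX hz]

/-- The derivative may hit any of the `n + 1` momentum factors, and by symmetry of the tensor all of
these terms are equal. -/
theorem fderiv_hamiltonian_dp_succ {X : TensorFamily d} {n : ℕ} (hQ : IsOpen Q)
    (hX : ContDiffOn ℝ ∞ (X (n + 1)) Q) {z : Phase d} (hz : z.1 ∈ Q)
    (hs : ∀ (i : Fin (n + 1) → Fin d) (τ : Equiv.Perm (Fin (n + 1))),
      X (n + 1) z.1 (i ∘ τ) = X (n + 1) z.1 i) (l : Fin d) :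
    fderiv ℝ (hamiltonian X (n + 1)) z (0, Pi.single l 1) =
      ((n + 1 : ℕ) : ℝ) * ∑ i, thetaPow n z i *
        X (n + 1) z.1 (Fin.snoc (α := fun _ => Fin d) i l) := by
  have key (j : Fin (n + 1)) : ∑ i : Fin (n + 1) → Fin d, X (n + 1) z.1 i *
      ((∏ k ∈ Finset.univ.erase j, z.2 (i k)) * (Pi.single l 1 : Fin d → ℝ) (i j)) =
      ∑ i, thetaPow n z i * X (n + 1) z.1 (Fin.snoc (α := fun _ => Fin d) i l) := by
    -- Split each multi-index into its entry at `j` and the rest; `Pi.single l 1` leaves only the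
    -- entry `l`.
    rw [← (Fin.insertNthEquiv (fun _ => Fin d) j).sum_comp, Fintype.sum_prod_type]
    rw [Finset.sum_eq_single l]
    · refine Finset.sum_congr rfl fun i _ => ?_
      have hu : Finset.univ.erase j = Finset.univ.image j.succAbove := by
        rw [Fin.image_succAbove_univ]; ext; simp
      change X (n + 1) z.1 (Fin.insertNth (α := fun _ => Fin d) j l i) *
        ((∏ k ∈ Finset.univ.erase j, z.2 (Fin.insertNth (α := fun _ => Fin d) j l i k)) *
          (Pi.single l 1 : Fin d → ℝ) (Fin.insertNth (α := fun _ => Fin d) j l i j)) = _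
      rw [apply_insertNth_of_symmetric hs, hu,
        Finset.prod_image j.succAbove_right_injective.injOn]
      simp [thetaPow, mul_comm]
    · intro a _ ha
      simp [ha]
    · simp
  rw [fderiv_hamiltonian hQ hX hz]
  simp only [map_zero, Pi.zero_apply, mul_zero, zero_add,
    Finset.mul_sum (Finset.univ : Finset (Fin (n + 1)))]
  rw [Finset.sum_comm, Finset.sum_congr rfl fun j _ => key j]
  simp

/-! ### The Hamiltonian of the Schouten concomitant -/

/-- This is `θ^{m+b} = θ^m ⊗ θ^b` contracted with a product of tensors. The equation `k = m + b` is
a hypothesis so that `b` can be the truncated difference `k - m`. -/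
theorem sum_thetaPow_mul_split {k m b : ℕ} (h : k = m + b) (z : Phase d)
    (f : (Fin m → Fin d) → ℝ) (g : (Fin b → Fin d) → ℝ) :
    ∑ i : Fin k → Fin d, thetaPow k z i *
      (g (fun j => i ⟨m + j, by omega⟩) * f (fun j => i ⟨j, by omega⟩)) =
      (∑ i, thetaPow m z i * f i) * ∑ i, thetaPow b z i * g i := by
  subst h
  rw [← (Fin.appendEquiv m b).sum_comp, Fintype.sum_prod_type, Finset.sum_mul_sum]
  refine Finset.sum_congr rfl fun i _ => Finset.sum_congr rfl fun j _ => ?_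
  have h1 : (fun a : Fin m => Fin.append i j ⟨a, by omega⟩) = i := by
    ext a; exact congrArg _ (Fin.append_left i j a)
  have h2 : (fun a : Fin b => Fin.append i j ⟨m + a, by omega⟩) = j := by
    ext a; exact congrArg _ (Fin.append_right i j a)
  simp only [Fin.appendEquiv, Equiv.coe_fn_mk, h1, h2]
  simp only [thetaPow, Fin.prod_univ_add, Fin.append_left, Fin.append_right]
  ring

/-- The weight `k - m + 1` and the free slot `l` of `X` are exactly what a `p_l`-derivative of its
Hamiltonian produces. That derivative lowers the degree by one, so degrees `x.1` and `x.2 + 1`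
contribute to order `x.1 + x.2`. -/
theorem sum_thetaPow_mul_schoutenHalf {X Y : TensorFamily d} (hQ : IsOpen Q)
    (hX : IsContravariant Q X) (hY : IsContravariant Q Y) (k : ℕ) {z : Phase d} (hz : z.1 ∈ Q) :
    ∑ i, thetaPow k z i * schoutenHalf X Y k z.1 i =
      ∑ l : Fin d, ∑ x ∈ Finset.HasAntidiagonal.antidiagonal k,
        fderiv ℝ (hamiltonian Y x.1) z (Pi.single l 1, 0) *
          fderiv ℝ (hamiltonian X (x.2 + 1)) z (0, Pi.single l 1) := by
  have e (l : Fin d) := (Finset.Nat.sum_antidiagonal_eq_sum_range_succ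
    (fun a b => fderiv ℝ (hamiltonian Y a) z (Pi.single l 1, 0) *
      fderiv ℝ (hamiltonian X (b + 1)) z (0, Pi.single l 1)) k).trans
    (Fin.sum_univ_eq_sum_range (fun a => fderiv ℝ (hamiltonian Y a) z
      (Pi.single l 1, 0) * fderiv ℝ (hamiltonian X (k - a + 1)) z (0, Pi.single l 1)) (k + 1)).symm
  rw [Finset.sum_congr rfl fun l _ => e l]
  simp only [schoutenHalf, Finset.mul_sum]
  rw [Finset.sum_comm, Finset.sum_comm (s := (Finset.univ : Finset (Fin d)))]
  refine Finset.sum_congr rfl fun m _ => ?_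
  rw [Finset.sum_comm]
  refine Finset.sum_congr rfl fun l _ => ?_
  rw [fderiv_hamiltonian_dq hQ (hY.1 m) hz,
    fderiv_hamiltonian_dp_succ hQ (hX.1 _) hz (hX.2.1 _ _ hz)]
  rw [mul_left_comm, ← sum_thetaPow_mul_split (k := k) (m := m) (b := k - m) (by omega) z
    (fun i => fderiv ℝ (Y m) z.1 (Pi.single l 1) i)
    (fun i => X (k - m + 1) z.1 (Fin.snoc (α := fun _ => Fin d) i l)), Finset.mul_sum]
  refine Finset.sum_congr rfl fun i _ => ?_
  ring

theorem hamiltonian_schouten {X Y : TensorFamily d} (hQ : IsOpen Q)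
    (hX : IsContravariant Q X) (hY : IsContravariant Q Y) (k : ℕ) {z : Phase d} (hz : z.1 ∈ Q) :
    hamiltonian (schouten X Y) k z =
      ∑ l : Fin d, ∑ x ∈ Finset.HasAntidiagonal.antidiagonal k,
        fderiv ℝ (hamiltonian Y x.1) z (Pi.single l 1, 0) *
          fderiv ℝ (hamiltonian X (x.2 + 1)) z (0, Pi.single l 1) -
      ∑ l : Fin d, ∑ x ∈ Finset.HasAntidiagonal.antidiagonal k,
        fderiv ℝ (hamiltonian X x.1) z (Pi.single l 1, 0) *
          fderiv ℝ (hamiltonian Y (x.2 + 1)) z (0, Pi.single l 1) := by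
  rw [← sum_thetaPow_mul_schoutenHalf hQ hX hY k hz, ← sum_thetaPow_mul_schoutenHalf hQ hY hX k hz,
    ← Finset.sum_sub_distrib, hamiltonian]
  simp only [schouten]
  rw [sum_mul_symmetrize (thetaPow_comp_perm z)]
  simp only [mul_sub]

theorem contDiffOn_schoutenHalf {X Y : TensorFamily d} (hQ : IsOpen Q)
    (hX : ∀ n, ContDiffOn ℝ ∞ (X n) Q) (hY : ∀ n, ContDiffOn ℝ ∞ (Y n) Q) (k : ℕ)
    (i : Fin k → Fin d) : ContDiffOn ℝ ∞ (fun q => schoutenHalf X Y k q i) Q := by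
  refine ContDiffOn.sum fun m _ => contDiffOn_const.mul <| ContDiffOn.sum fun l _ => ?_
  refine (contDiffOn_pi.1 (hX _) _).mul (contDiffOn_pi.1 ?_ _)
  exact ((hY m).fderiv_of_isOpen hQ (by simp)).clm_apply contDiffOn_const

theorem IsContravariant.schouten {X Y : TensorFamily d} (hQ : IsOpen Q)
    (hX : IsContravariant Q X) (hY : IsContravariant Q Y) :
    IsContravariant Q (schouten X Y) := by
  have ho := isOpen_cotangent hQ
  refine ⟨fun n => contDiffOn_pi.2 fun i => ?_, fun n q _ i τ => symmetrize_comp_perm _ i τ, ?_⟩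
  · refine contDiffOn_const.mul <| ContDiffOn.sum fun τ _ => ?_
    exact (contDiffOn_schoutenHalf hQ hX.1 hY.1 n _).sub (contDiffOn_schoutenHalf hQ hY.1 hX.1 n _)
  -- The Hamiltonians of the concomitant are Cauchy products of derivative series, the one in `p`
  -- shifted by one; normal convergence is inherited.
  · have h {X Y : TensorFamily d} (hX : IsContravariant Q X) (hY : IsContravariant Q Y) :=
      NormallySummableOn.sum (t := Finset.univ) ho fun (l : Fin d) _ =>
        (hY.normallySummableOn.fderiv_apply ho (Pi.single l 1, 0)).mul
          (hX.normallySummableOn.shift.fderiv_apply ho (0, Pi.single l 1)) ho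
    exact (((h hX hY).sub (h hY hX) ho).congr ho fun n z hz =>
      hamiltonian_schouten hQ hX hY n (mem_cotangent.1 hz)).bound

/-! ### Hamiltonian vector fields -/

theorem clm_apply_phase (L : Phase d →L[ℝ] ℝ) (w : Phase d) :
    L w = ∑ l, (w.1 l * L (Pi.single l 1, 0) + w.2 l * L (0, Pi.single l 1)) := by
  have h : w = ∑ l, (w.1 l • ((Pi.single l 1, 0) : Phase d) +
      w.2 l • ((0, Pi.single l 1) : Phase d)) := by
    ext j <;> simp [Prod.fst_sum, Prod.snd_sum, Finset.sum_apply, Pi.single_apply]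
  conv_lhs => rw [h]
  simp only [map_sum, map_add, map_smul, smul_eq_mul]

theorem hamiltonianField_congr {f g : Phase d → ℝ} {z : Phase d} (h : f =ᶠ[nhds z] g) :
    hamiltonianField f z = hamiltonianField g z := by
  simp [hamiltonianField, h.fderiv_eq]

theorem contDiffOn_hamiltonianField {h : Phase d → ℝ} (hQ : IsOpen Q)
    (hh : ContDiffOn ℝ ∞ h (cotangent Q)) : ContDiffOn ℝ ∞ (hamiltonianField h) (cotangent Q) := by
  have hd := hh.fderiv_of_isOpen (m := ∞) (isOpen_cotangent hQ) (by simp)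
  exact (contDiffOn_pi.2 fun l => hd.clm_apply contDiffOn_const).prodMk
    (contDiffOn_pi.2 fun l => (hd.clm_apply contDiffOn_const).neg)

theorem IsHamiltonianField.contDiffOn {U : Phase d → Phase d} (hQ : IsOpen Q)
    (hU : IsHamiltonianField Q U) : ContDiffOn ℝ ∞ U (cotangent Q) := by
  obtain ⟨h, hh, hU⟩ := hU
  exact (contDiffOn_hamiltonianField hQ hh).congr hU

/-- The Poisson bracket `∇_p f · ∇_q g - ∇_q f · ∇_p g`, the Hamiltonian of the
Jacobi-Lie bracket of the Hamiltonian vector fields of `f` and `g`. -/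
noncomputable def canonicalBracket (f g : Phase d → ℝ) (z : Phase d) : ℝ :=
  fderiv ℝ g z (hamiltonianField f z)

theorem canonicalBracket_eq_sum (f g : Phase d → ℝ) (z : Phase d) :
    canonicalBracket f g z =
      ∑ l, fderiv ℝ g z (Pi.single l 1, 0) * fderiv ℝ f z (0, Pi.single l 1) -
      ∑ l, fderiv ℝ f z (Pi.single l 1, 0) * fderiv ℝ g z (0, Pi.single l 1) := by
  rw [canonicalBracket, clm_apply_phase, ← Finset.sum_sub_distrib]
  refine Finset.sum_congr rfl fun l _ => ?_
  simp only [hamiltonianField]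
  ring

theorem differentiableAt_hamiltonianField_and_fderiv {f : Phase d → ℝ} {z : Phase d}
    (hf : ContDiffAt ℝ ∞ f z) :
    DifferentiableAt ℝ (hamiltonianField f) z ∧ ∀ v, fderiv ℝ (hamiltonianField f) z v =
      (fun l => fderiv ℝ (fderiv ℝ f) z v (0, Pi.single l 1),
        fun l => -fderiv ℝ (fderiv ℝ f) z v (Pi.single l 1, 0)) := by
  have hd : HasFDerivAt (fderiv ℝ f) (fderiv ℝ (fderiv ℝ f) z) z :=
    ((hf.fderiv_right (m := 1) (by norm_cast)).differentiableAt (by simp)).hasFDerivAt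
  have h1 (w : Phase d) : HasFDerivAt (fun y => fderiv ℝ f y w)
      ((ContinuousLinearMap.apply ℝ ℝ w).comp (fderiv ℝ (fderiv ℝ f) z)) z :=
    (ContinuousLinearMap.apply ℝ ℝ w).hasFDerivAt.comp z hd
  have := (hasFDerivAt_pi.2 fun l : Fin d => h1 (0, Pi.single l 1)).prodMk
    (hasFDerivAt_pi.2 fun l : Fin d => (h1 (Pi.single l 1, 0)).neg)
  refine ⟨this.differentiableAt, fun v => ?_⟩
  have e : fderiv ℝ (hamiltonianField f) z = _ := this.fderiv
  rw [e]
  ext l <;> simp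

theorem fderiv_canonicalBracket {f g : Phase d → ℝ} {z : Phase d} (hf : ContDiffAt ℝ ∞ f z)
    (hg : ContDiffAt ℝ ∞ g z) (v : Phase d) :
    fderiv ℝ (canonicalBracket f g) z v = fderiv ℝ (fderiv ℝ g) z v (hamiltonianField f z) -
      fderiv ℝ (fderiv ℝ f) z v (hamiltonianField g z) := by
  have hd : HasFDerivAt (fderiv ℝ g) (fderiv ℝ (fderiv ℝ g) z) z :=
    ((hg.fderiv_right (m := 1) (by norm_cast)).differentiableAt (by simp)).hasFDerivAt
  have h := hd.clm_apply (differentiableAt_hamiltonianField_and_fderiv hf).1.hasFDerivAt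
  have e : fderiv ℝ (canonicalBracket f g) z = _ := h.fderiv
  rw [e]
  simp only [add_apply, ContinuousLinearMap.comp_apply, ContinuousLinearMap.flip_apply,
    (differentiableAt_hamiltonianField_and_fderiv hf).2]
  rw [add_comm, sub_eq_add_neg]
  congr 1
  -- The remaining term `dg(DX_f · v)` equals `-D²f(v, X_g)` because the canonical pairing of `q`
  -- and `p` is antisymmetric.
  rw [clm_apply_phase, clm_apply_phase, ← Finset.sum_neg_distrib]
  refine Finset.sum_congr rfl fun l _ => ?_
  simp only [hamiltonianField]
  ring

theorem fderiv_fderiv_apply_comm {F : Type} [NormedAddCommGroup F] [NormedSpace ℝ F]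
    {f : Phase d → F} {z : Phase d} (hf : ContDiffAt ℝ ∞ f z) (v w : Phase d) :
    fderiv ℝ (fderiv ℝ f) z v w = fderiv ℝ (fderiv ℝ f) z w v :=
  (hf.isSymmSndFDerivAt (by simp; norm_cast)) v w

/-- Both sides are linear in the second derivatives of `f` and `g`, and they agree componentwise by
symmetry of the Hessians. -/
theorem lieBracket_hamiltonianField {f g : Phase d → ℝ} {z : Phase d} (hf : ContDiffAt ℝ ∞ f z)
    (hg : ContDiffAt ℝ ∞ g z) :
    VectorField.lieBracket ℝ (hamiltonianField f) (hamiltonianField g) z =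
      hamiltonianField (canonicalBracket f g) z := by
  rw [VectorField.lieBracket, (differentiableAt_hamiltonianField_and_fderiv hf).2,
    (differentiableAt_hamiltonianField_and_fderiv hg).2]
  ext l
  · simp [hamiltonianField, fderiv_canonicalBracket hf hg,
      fderiv_fderiv_apply_comm hf (0, _),
      fderiv_fderiv_apply_comm hg (0, _)]
  · simp [hamiltonianField, fderiv_canonicalBracket hf hg,
      fderiv_fderiv_apply_comm hf (Pi.single l 1, _),
      fderiv_fderiv_apply_comm hg (Pi.single l 1, _)]
    ring

/-! ### The generalized complete cotangent lift -/

/-- The Hamiltonian `H_X = ∑ H_{X^n}`. -/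
noncomputable def totalHamiltonian (X : TensorFamily d) (z : Phase d) : ℝ :=
  ∑' n, hamiltonian X n z

theorem IsContravariant.contDiffOn_totalHamiltonian {X : TensorFamily d} (hQ : IsOpen Q)
    (hX : IsContravariant Q X) : ContDiffOn ℝ ∞ (totalHamiltonian X) (cotangent Q) :=
  hX.normallySummableOn.contDiffOn_tsum (isOpen_cotangent hQ)

theorem IsContravariant.hasSum_hamiltonianField {X : TensorFamily d} (hQ : IsOpen Q)
    (hX : IsContravariant Q X) {z : Phase d} (hz : z ∈ cotangent Q) :
    HasSum (fun n => hamiltonianField (hamiltonian X n) z)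
      (hamiltonianField (totalHamiltonian X) z) := by
  have h := hX.normallySummableOn.hasSum_fderiv_apply (isOpen_cotangent hQ) hz
  exact (Pi.hasSum.2 fun l => h (0, Pi.single l 1)).prodMk
    (Pi.hasSum.2 fun l => (h (Pi.single l 1, 0)).neg)

theorem IsContravariant.completeLift_eq {X : TensorFamily d} (hQ : IsOpen Q)
    (hX : IsContravariant Q X) {z : Phase d} (hz : z ∈ cotangent Q) :
    completeLift X z = hamiltonianField (totalHamiltonian X) z :=
  (hX.hasSum_hamiltonianField hQ hz).tsum_eq

theorem IsContravariant.isHamiltonianField {X : TensorFamily d} (hQ : IsOpen Q)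
    (hX : IsContravariant Q X) : IsHamiltonianField Q (completeLift X) :=
  ⟨totalHamiltonian X, hX.contDiffOn_totalHamiltonian hQ, fun _ hz => hX.completeLift_eq hQ hz⟩

/-- No convergence is required: the scalar is pulled out of `tsum` unconditionally. It serves to
handle the sign `σ`. -/
theorem completeLift_smul (c : ℝ) (X : TensorFamily d) :
    completeLift (c • X) = c • completeLift X := by
  ext1 z
  have hh (n : ℕ) : hamiltonian (c • X) n = c • hamiltonian X n := by
    ext y
    simp [hamiltonian, Finset.mul_sum, mul_left_comm]
  have hf (n : ℕ) : hamiltonianField (hamiltonian (c • X) n) z =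
      c • hamiltonianField (hamiltonian X n) z := by
    rw [hh, hamiltonianField, fderiv_const_smul_field]
    ext l <;> simp [hamiltonianField]
  simp only [completeLift, hf, Pi.smul_apply]
  exact tsum_const_smul'' c

theorem totalHamiltonian_schouten {X Y : TensorFamily d} (hQ : IsOpen Q)
    (hX : IsContravariant Q X) (hY : IsContravariant Q Y) {z : Phase d} (hz : z ∈ cotangent Q) :
    totalHamiltonian (schouten X Y) z =
      canonicalBracket (totalHamiltonian X) (totalHamiltonian Y) z := by
  have ho := isOpen_cotangent hQ
  have key {X Y : TensorFamily d} (hX : IsContravariant Q X) (hY : IsContravariant Q Y)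
      (l : Fin d) : HasSum (fun k => ∑ x ∈ Finset.HasAntidiagonal.antidiagonal k,
        fderiv ℝ (hamiltonian Y x.1) z (Pi.single l 1, 0) *
          fderiv ℝ (hamiltonian X (x.2 + 1)) z (0, Pi.single l 1))
      (fderiv ℝ (totalHamiltonian Y) z (Pi.single l 1, 0) *
        fderiv ℝ (totalHamiltonian X) z (0, Pi.single l 1)) := by
    have nY := hY.normallySummableOn.fderiv_apply ho (Pi.single l 1, 0)
    have nX := hX.normallySummableOn.shift.fderiv_apply ho (0, Pi.single l 1)
    have sX := hX.normallySummableOn.hasSum_fderiv_apply ho hz (0, Pi.single l 1)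
    have sY := hY.normallySummableOn.hasSum_fderiv_apply ho hz (Pi.single l 1, 0)
    -- The Hamiltonian of order `0` does not depend on `p`, so the series may start at order `1`, as
    -- the Cauchy product requires.
    have e : fderiv ℝ (totalHamiltonian X) z (0, Pi.single l 1) =
        ∑' n, fderiv ℝ (hamiltonian X (n + 1)) z (0, Pi.single l 1) := by
      rw [((hasSum_nat_add_iff' 1).2 sX).tsum_eq]
      simp [fderiv_hamiltonian_dp_zero hQ (hX.1 0) (mem_cotangent.1 hz)]
      rfl
    have e' : fderiv ℝ (totalHamiltonian Y) z (Pi.single l 1, 0) =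
        ∑' n, fderiv ℝ (hamiltonian Y n) z (Pi.single l 1, 0) := sY.tsum_eq.symm
    rw [e, e', tsum_mul_tsum_eq_tsum_sum_antidiagonal_of_summable_norm (nY.summable_norm hz)
      (nX.summable_norm hz)]
    exact ((nY.mul nX ho).hasSum hz)
  rw [canonicalBracket_eq_sum]
  refine HasSum.tsum_eq ?_
  simp only [hamiltonian_schouten hQ hX hY _ (mem_cotangent.1 hz)]
  exact (hasSum_sum fun l _ => key hX hY l).sub (hasSum_sum fun l _ => key hY hX l)

/-- The homomorphism property. The lifts are known to be Hamiltonian only over `Q`, which suffices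
since the Lie bracket is local and `Q` is open. -/
theorem completeLift_schouten {X Y : TensorFamily d} (hQ : IsOpen Q)
    (hX : IsContravariant Q X) (hY : IsContravariant Q Y) {z : Phase d} (hz : z ∈ cotangent Q) :
    completeLift (schouten X Y) z =
      VectorField.lieBracket ℝ (completeLift X) (completeLift Y) z := by
  have hn := (isOpen_cotangent hQ).mem_nhds hz
  have e {X : TensorFamily d} (hX : IsContravariant Q X) :
      completeLift X =ᶠ[nhds z] hamiltonianField (totalHamiltonian X) :=
    Filter.eventuallyEq_of_mem hn fun y hy => hX.completeLift_eq hQ hy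
  rw [(e hX).lieBracket_vectorField_eq (e hY), lieBracket_hamiltonianField
    ((hX.contDiffOn_totalHamiltonian hQ).contDiffAt hn)
    ((hY.contDiffOn_totalHamiltonian hQ).contDiffAt hn), (hX.schouten hQ hY).completeLift_eq hQ hz]
  exact hamiltonianField_congr (Filter.eventuallyEq_of_mem hn fun y hy =>
    totalHamiltonian_schouten hQ hX hY hy)

/-! ### The Lie derivative of one-forms -/

theorem fderiv_lieDerivative_apply {U : Phase d → Phase d} {η : OneForm d} {z : Phase d}
    (hU : ContDiffAt ℝ ∞ U z) (hη : ContDiffAt ℝ ∞ η z) (v w : Phase d) :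
    fderiv ℝ (lieDerivative U η) z v w = fderiv ℝ (fderiv ℝ η) z v (U z) w +
      fderiv ℝ η z (fderiv ℝ U z v) w + fderiv ℝ η z v (fderiv ℝ U z w) +
      η z (fderiv ℝ (fderiv ℝ U) z v w) := by
  have hU1 := (hU.differentiableAt (by simp)).hasFDerivAt
  have hη1 := (hη.differentiableAt (by simp)).hasFDerivAt
  have hU2 := ((hU.fderiv_right (m := 1) (by norm_cast)).differentiableAt (by simp)).hasFDerivAt
  have hη2 := ((hη.fderiv_right (m := 1) (by norm_cast)).differentiableAt (by simp)).hasFDerivAt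
  have e : fderiv ℝ (lieDerivative U η) z = _ :=
    ((hη2.clm_apply hU1).add (hη1.clm_comp hU2)).fderiv
  rw [e]
  simp
  ring

/-- This is `L_{[U,V]} = [L_U, L_V]`: after expansion the surplus second-order terms cancel by
symmetry of second derivatives. -/
theorem lieDerivative_lieBracket {U V : Phase d → Phase d} {η : OneForm d} {z : Phase d}
    (hU : ContDiffAt ℝ ∞ U z) (hV : ContDiffAt ℝ ∞ V z) (hη : ContDiffAt ℝ ∞ η z) :
    lieDerivative (VectorField.lieBracket ℝ U V) η z =
      lieDerivative U (lieDerivative V η) z - lieDerivative V (lieDerivative U η) z := by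
  have hU1 := (hU.differentiableAt (by simp)).hasFDerivAt
  have hV1 := (hV.differentiableAt (by simp)).hasFDerivAt
  have hU2 := ((hU.fderiv_right (m := 1) (by norm_cast)).differentiableAt (by simp)).hasFDerivAt
  have hV2 := ((hV.fderiv_right (m := 1) (by norm_cast)).differentiableAt (by simp)).hasFDerivAt
  have e : fderiv ℝ (VectorField.lieBracket ℝ U V) z = _ :=
    ((hV2.clm_apply hU1).sub (hU2.clm_apply hV1)).fderiv
  refine ContinuousLinearMap.ext fun w => ?_
  rw [lieDerivative, lieDerivative, lieDerivative.eq_1 V (lieDerivative U η)]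
  simp only [add_apply, sub_apply, ContinuousLinearMap.comp_apply]
  rw [fderiv_lieDerivative_apply hV hη, fderiv_lieDerivative_apply hU hη, e]
  simp only [lieDerivative, VectorField.lieBracket, add_apply, sub_apply, map_sub, map_add,
    ContinuousLinearMap.comp_apply, ContinuousLinearMap.flip_apply]
  rw [fderiv_fderiv_apply_comm hU w, fderiv_fderiv_apply_comm hV w,
    fderiv_fderiv_apply_comm hη (U z)]
  ring

theorem lieDerivative_eq_zero_of_notMem {U : Phase d → Phase d} {η : OneForm d} {z : Phase d}
    (hz : z ∉ tsupport η) : lieDerivative U η z = 0 := by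
  have h := notMem_tsupport_iff_eventuallyEq.1 hz
  have h1 : fderiv ℝ η z = 0 := by
    rw [h.fderiv_eq]; exact fderiv_const_apply 0
  rw [lieDerivative, h1, h.eq_of_nhds]
  exact ContinuousLinearMap.ext fun w => by simp

theorem lieDerivative_smul (c : ℝ) (U : Phase d → Phase d) (η : OneForm d) :
    lieDerivative U (c • η) = c • lieDerivative U η := by
  ext1 z
  have h : fderiv ℝ (c • η) = c • fderiv ℝ η := by
    exact fderiv_const_smul_field (𝕜 := ℝ) (F := Phase d →L[ℝ] ℝ) (f := η) c
  rw [lieDerivative, h]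
  refine ContinuousLinearMap.ext fun w => ?_
  simp [lieDerivative]

theorem lieDerivative_smul_left {c : ℝ} {U : Phase d → Phase d} (η : OneForm d) :
    lieDerivative (c • U) η = c • lieDerivative U η := by
  ext1 z
  rw [lieDerivative, fderiv_const_smul_field]
  refine ContinuousLinearMap.ext fun w => ?_
  simp [lieDerivative]

/-! ### Momentum one-forms and their pairing with vector fields -/

theorem IsMomentumForm.of_tsupport_subset {η ζ : OneForm d} (hQ : IsOpen Q)
    (hη : IsMomentumForm Q η) (hζ : ContDiffOn ℝ ∞ ζ (cotangent Q))
    (h : ∀ z ∉ tsupport η, ζ z = 0) : IsMomentumForm Q ζ := by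
  have hs : tsupport ζ ⊆ tsupport η := closure_minimal
    (fun z hz => by_contra fun hz' => hz (h z hz')) (isClosed_tsupport η)
  exact ⟨contDiff_of_tsupport_subset (isOpen_cotangent hQ) hζ (hs.trans hη.2.2),
    hη.2.1.of_isClosed_subset (isClosed_tsupport ζ) hs, hs.trans hη.2.2⟩

theorem IsMomentumForm.smul {η : OneForm d} (hη : IsMomentumForm Q η) (c : ℝ) :
    IsMomentumForm Q (c • η) :=
  ⟨hη.1.const_smul c, hη.2.1.smul_left (f := fun _ => c),
    (tsupport_smul_subset_right (fun _ => c) η).trans hη.2.2⟩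

theorem IsMomentumForm.add {η ζ : OneForm d} (hη : IsMomentumForm Q η)
    (hζ : IsMomentumForm Q ζ) : IsMomentumForm Q (η + ζ) :=
  ⟨hη.1.add hζ.1, hη.2.1.add hζ.2.1,
    (tsupport_add η ζ).trans (union_subset hη.2.2 hζ.2.2)⟩

theorem IsMomentumForm.lieDerivative {η : OneForm d} (hQ : IsOpen Q) (hη : IsMomentumForm Q η)
    {U : Phase d → Phase d} (hU : ContDiffOn ℝ ∞ U (cotangent Q)) :
    IsMomentumForm Q (lieDerivative U η) := by
  refine hη.of_tsupport_subset hQ ?_ fun z hz => lieDerivative_eq_zero_of_notMem hz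
  have hU' := hU.fderiv_of_isOpen (m := ∞) (isOpen_cotangent hQ) (by simp)
  have hη' := hη.1.fderiv_right (m := ∞) (by simp)
  exact (hη'.contDiffOn.clm_apply hU).add (hη.1.contDiffOn.clm_comp hU')

theorem tsupport_apply_subset (η : OneForm d) (U : Phase d → Phase d) :
    tsupport (fun z => η z (U z)) ⊆ tsupport η :=
  closure_mono fun z hz hz' => hz (by simp [hz'])

theorem IsMomentumForm.contDiff_apply {η : OneForm d} (hQ : IsOpen Q) (hη : IsMomentumForm Q η)
    {U : Phase d → Phase d} (hU : ContDiffOn ℝ ∞ U (cotangent Q)) :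
    ContDiff ℝ ∞ (fun z => η z (U z)) ∧ HasCompactSupport (fun z => η z (U z)) ∧
      tsupport (fun z => η z (U z)) ⊆ cotangent Q := by
  have hs := tsupport_apply_subset η U
  exact ⟨contDiff_of_tsupport_subset (isOpen_cotangent hQ) (hη.1.contDiffOn.clm_apply hU)
    (hs.trans hη.2.2), hη.2.1.of_isClosed_subset (isClosed_tsupport _) hs, hs.trans hη.2.2⟩

theorem IsMomentumForm.integrable {η : OneForm d} (hQ : IsOpen Q) (hη : IsMomentumForm Q η)
    {U : Phase d → Phase d} (hU : ContDiffOn ℝ ∞ U (cotangent Q)) :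
    Integrable (fun z => η z (U z)) :=
  have h := hη.contDiff_apply hQ hU
  h.1.continuous.integrable_of_hasCompactSupport h.2.1

theorem IsMomentumForm.phasePairing_eq {η : OneForm d} (hη : IsMomentumForm Q η)
    (U : Phase d → Phase d) : phasePairing Q η U = ∫ z, η z (U z) :=
  setIntegral_eq_integral_of_forall_compl_eq_zero fun z hz => by
    simp [image_eq_zero_of_notMem_tsupport fun h => hz (hη.2.2 h)]

theorem phasePairing_congr (hQ : IsOpen Q) {η ζ : OneForm d} {U V : Phase d → Phase d}
    (h : ∀ z ∈ cotangent Q, η z (U z) = ζ z (V z)) : phasePairing Q η U = phasePairing Q ζ V :=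
  setIntegral_congr_fun (isOpen_cotangent hQ).measurableSet h

theorem phasePairing_add_smul {η ζ : OneForm d} (hQ : IsOpen Q) (hη : IsMomentumForm Q η)
    (hζ : IsMomentumForm Q ζ) {U : Phase d → Phase d} (hU : ContDiffOn ℝ ∞ U (cotangent Q))
    (c : ℝ) : phasePairing Q (η + c • ζ) U = phasePairing Q η U + c * phasePairing Q ζ U := by
  unfold phasePairing
  rw [← integral_const_mul, ← integral_add (hη.integrable hQ hU).integrableOn
    ((hζ.integrable hQ hU).integrableOn.const_mul c)]
  simp

theorem phasePairing_smul (c : ℝ) (η : OneForm d) (U : Phase d → Phase d) :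
    phasePairing Q (c • η) U = c * phasePairing Q η U := by
  unfold phasePairing
  rw [← integral_const_mul]
  simp

theorem isMomentumForm_fderiv {k : Phase d → ℝ} (hk : ContDiff ℝ ∞ k) (hc : HasCompactSupport k)
    (hs : tsupport k ⊆ cotangent Q) : IsMomentumForm Q (fderiv ℝ k) :=
  ⟨hk.fderiv_right (by simp), hc.fderiv ℝ, (tsupport_fderiv_subset ℝ).trans hs⟩

instance isAddHaarMeasure_phase : (volume : Measure (Phase d)).IsAddHaarMeasure :=
  Measure.prod.instIsAddHaarMeasure volume volume

/-- Hamiltonian vector fields are divergence-free. -/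
theorem phasePairing_fderiv_hamiltonianField (hQ : IsOpen Q) {k : Phase d → ℝ}
    (hk : ContDiff ℝ ∞ k) (hc : HasCompactSupport k) (hs : tsupport k ⊆ cotangent Q)
    {U : Phase d → Phase d} (hU : IsHamiltonianField Q U) :
    phasePairing Q (fderiv ℝ k) U = 0 := by
  obtain ⟨h, hh, hU⟩ := hU
  have ho := isOpen_cotangent hQ
  have hd := hh.fderiv_of_isOpen (m := ∞) ho (by simp)
  have hsub (w : Phase d) : tsupport (fun z => k z * fderiv ℝ h z w) ⊆ tsupport k :=
    tsupport_mul_subset_left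
  have hg (w : Phase d) : ContDiff ℝ ∞ fun z => k z * fderiv ℝ h z w :=
    contDiff_of_tsupport_subset ho (hk.contDiffOn.mul (hd.clm_apply contDiffOn_const))
      ((hsub w).trans hs)
  have hgc (w : Phase d) : HasCompactSupport fun z => k z * fderiv ℝ h z w := hc.mul_right
  have hi (v w : Phase d) : Integrable fun z => fderiv ℝ (fun y => k y * fderiv ℝ h y w) z v :=
    (((hg w).continuous_fderiv (by simp)).clm_apply
      continuous_const).integrable_of_hasCompactSupport ((hgc w).fderiv_apply ℝ v)
  -- On the support of `k` the mixed second derivatives of `h` cancel, which puts `dk(X_h)` in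
  -- divergence form; elsewhere everything vanishes, whatever `h` is there.
  have e : ∀ z, fderiv ℝ k z (U z) =
      ∑ l : Fin d, (fderiv ℝ (fun y => k y * fderiv ℝ h y (0, Pi.single l 1)) z (Pi.single l 1, 0) -
        fderiv ℝ (fun y => k y * fderiv ℝ h y (Pi.single l 1, 0)) z (0, Pi.single l 1)) := by
    intro z
    by_cases hz : z ∈ tsupport k
    · have hn := ho.mem_nhds (hs hz)
      have ha := hh.contDiffAt hn
      have h2 := ((ha.fderiv_right (m := 1) (by norm_cast)).differentiableAt (by simp)).hasFDerivAt
      have hp (v w : Phase d) : fderiv ℝ (fun y => k y * fderiv ℝ h y w) z v =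
          k z * fderiv ℝ (fderiv ℝ h) z v w + fderiv ℝ h z w * fderiv ℝ k z v := by
        have h3 : HasFDerivAt (fun y => fderiv ℝ h y w)
            ((ContinuousLinearMap.apply ℝ ℝ w).comp (fderiv ℝ (fderiv ℝ h) z)) z :=
          (ContinuousLinearMap.apply ℝ ℝ w).hasFDerivAt.comp z h2
        rw [((hk.differentiable (by simp) z).hasFDerivAt.fun_mul h3).fderiv]
        simp
      rw [hU z (hs hz), clm_apply_phase]
      refine Finset.sum_congr rfl fun l _ => ?_
      rw [hp, hp, fderiv_fderiv_apply_comm ha (Pi.single l 1, 0)]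
      simp only [hamiltonianField]
      ring
    · have h0 (w : Phase d) : fderiv ℝ (fun y => k y * fderiv ℝ h y w) z = 0 :=
        image_eq_zero_of_notMem_tsupport fun h' => hz (hsub w (tsupport_fderiv_subset ℝ h'))
      have h1 : fderiv ℝ k z = 0 :=
        image_eq_zero_of_notMem_tsupport fun h' => hz (tsupport_fderiv_subset ℝ h')
      simp [h0, h1]
  rw [(isMomentumForm_fderiv hk hc hs).phasePairing_eq]
  simp only [e]
  rw [integral_finsetSum _ fun l _ => by exact (hi _ _).sub (hi _ _)]
  refine Finset.sum_eq_zero fun l _ => ?_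
  rw [integral_sub (hi _ _) (hi _ _), integral_fderiv_apply_eq_zero _ (hg _) (hgc _),
    integral_fderiv_apply_eq_zero _ (hg _) (hgc _), sub_zero]

/-- The two integrands differ by `d(η(U))(V)`, whose integral vanishes because `V` is
divergence-free and `η(U)` has compact support in `T^*Q`. -/
theorem phasePairing_lieDerivative (hQ : IsOpen Q) {η : OneForm d} (hη : IsMomentumForm Q η)
    {U V : Phase d → Phase d} (hU : ContDiffOn ℝ ∞ U (cotangent Q))
    (hV : IsHamiltonianField Q V) :
    phasePairing Q (lieDerivative V η) U = phasePairing Q η (VectorField.lieBracket ℝ U V) := by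
  have ho := isOpen_cotangent hQ
  have hV' := hV.contDiffOn hQ
  have hUd := hU.fderiv_of_isOpen (m := ∞) ho (by simp)
  have hVd := hV'.fderiv_of_isOpen (m := ∞) ho (by simp)
  have hb : ContDiffOn ℝ ∞ (VectorField.lieBracket ℝ U V) (cotangent Q) :=
    (hVd.clm_apply hU).sub (hUd.clm_apply hV')
  obtain ⟨h1, h2, h3⟩ := hη.contDiff_apply hQ hU
  rw [← sub_eq_zero, ← phasePairing_fderiv_hamiltonianField hQ h1 h2 h3 hV]
  unfold phasePairing
  rw [← integral_sub ((hη.lieDerivative hQ hV').integrable hQ hU).integrableOn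
    (hη.integrable hQ hb).integrableOn]
  refine setIntegral_congr_fun ho.measurableSet fun z hz => ?_
  have hUz := ((hU.contDiffAt (ho.mem_nhds hz)).differentiableAt (by simp)).hasFDerivAt
  rw [((hη.1.differentiable (by simp) z).hasFDerivAt.clm_apply hUz).fderiv]
  simp [lieDerivative, VectorField.lieBracket]
  ring

/-! ### Uniqueness of functional derivatives -/

/-- The fundamental lemma of the calculus of variations, with test forms `g • L` for bump functions
`g` and constant covectors `L`; continuity upgrades almost everywhere to everywhere. -/
theorem eqOn_of_phasePairing_eq (hQ : IsOpen Q) {U V : Phase d → Phase d}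
    (hU : ContDiffOn ℝ ∞ U (cotangent Q)) (hV : ContDiffOn ℝ ∞ V (cotangent Q))
    (h : ∀ ζ, IsMomentumForm Q ζ → phasePairing Q ζ U = phasePairing Q ζ V) :
    EqOn U V (cotangent Q) := by
  have ho := isOpen_cotangent hQ
  have key (L : Phase d →L[ℝ] ℝ) : EqOn (fun z => L (U z - V z)) 0 (cotangent Q) := by
    have hc : ContinuousOn (fun z => L (U z - V z)) (cotangent Q) :=
      L.continuous.comp_continuousOn (hU.continuousOn.sub hV.continuousOn)
    refine Measure.eqOn_open_of_ae_eq (μ := volume) ?_ ho hc continuousOn_const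
    rw [Filter.EventuallyEq, ae_restrict_iff' ho.measurableSet]
    refine ho.ae_eq_zero_of_integral_contDiff_smul_eq_zero
      (hc.locallyIntegrableOn ho.measurableSet) fun g hg hgc hgs => ?_
    have hζ : IsMomentumForm Q (fun z => g z • L) :=
      ⟨hg.smul contDiff_const, hgc.smul_right, (tsupport_smul_subset_left g _).trans hgs⟩
    have := h _ hζ
    rw [hζ.phasePairing_eq, hζ.phasePairing_eq, ← sub_eq_zero,
      ← integral_sub (hζ.integrable hQ hU) (hζ.integrable hQ hV)] at this
    simpa [mul_sub] using this
  intro z hz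
  rw [← sub_eq_zero]
  ext l
  · simpa using key ((ContinuousLinearMap.proj (R := ℝ) (φ := fun _ : Fin d => ℝ) l).comp
      (ContinuousLinearMap.fst ℝ _ _)) hz
  · simpa using key ((ContinuousLinearMap.proj (R := ℝ) (φ := fun _ : Fin d => ℝ) l).comp
      (ContinuousLinearMap.snd ℝ _ _)) hz

theorem IsPhaseDerivative.eqOn (hQ : IsOpen Q) {K : OneForm d → ℝ} {η : OneForm d}
    {U V : Phase d → Phase d} (hU : IsPhaseDerivative Q K η U) (hV : IsPhaseDerivative Q K η V) :
    EqOn U V (cotangent Q) :=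
  eqOn_of_phasePairing_eq hQ (hU.1.contDiffOn hQ) (hV.1.contDiffOn hQ) fun ζ hζ =>
    (hU.2 ζ hζ).unique (hV.2 ζ hζ)

/-- Any representatives of the functional derivatives may be used: they agree on the open set
`T^*Q`, hence so do their brackets there. -/
theorem liePoisson_eq (hQ : IsOpen Q) (σ : ℤˣ) {K H : OneForm d → ℝ} {η : OneForm d}
    {U V : Phase d → Phase d} (hU : IsPhaseDerivative Q K η U) (hV : IsPhaseDerivative Q H η V) :
    liePoisson Q σ K H η = sgn σ * phasePairing Q η (VectorField.lieBracket ℝ U V) := by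
  have e1 : EqOn (phaseDerivative Q K η) U (cotangent Q) :=
    (Classical.epsilon_spec ⟨U, hU⟩ : IsPhaseDerivative Q K η (phaseDerivative Q K η)).eqOn hQ hU
  have e2 : EqOn (phaseDerivative Q H η) V (cotangent Q) :=
    (Classical.epsilon_spec ⟨V, hV⟩ : IsPhaseDerivative Q H η (phaseDerivative Q H η)).eqOn hQ hV
  rw [liePoisson, phasePairing_congr hQ fun z hz => ?_]
  have hn := (isOpen_cotangent hQ).mem_nhds hz
  rw [(e1.eventuallyEq_of_mem hn).lieBracket_vectorField_eq (e2.eventuallyEq_of_mem hn)]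

theorem sgn_mul_self (σ : ℤˣ) : sgn σ * sgn σ = 1 := by
  rcases Int.units_eq_one_or σ with rfl | rfl <;> simp [sgn]

/-! ### Integration over the fibres -/

theorem integrable_slice {f : Phase d → ℝ} (hf : Continuous f) (hc : HasCompactSupport f)
    (q : Fin d → ℝ) : Integrable fun p : Fin d → ℝ => f (q, p) := by
  refine (hf.comp (Continuous.prodMk_right q)).integrable_of_hasCompactSupport
    (HasCompactSupport.intro (hc.image continuous_snd) fun p hp => ?_)
  exact image_eq_zero_of_notMem_tsupport (f := f) (x := (q, p)) fun h => hp ⟨(q, p), h, rfl⟩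

theorem contDiff_integral_slice {f : Phase d → ℝ} (hf : ContDiff ℝ ∞ f)
    (hc : HasCompactSupport f) : ContDiff ℝ ∞ fun q : Fin d → ℝ => ∫ p : Fin d → ℝ, f (q, p) := by
  rw [← contDiffOn_univ]
  have hk : IsCompact ((fun p : Fin d → ℝ => -p) '' (Prod.snd '' tsupport f)) :=
    (IsCompact.image hc continuous_snd).image continuous_neg
  -- The fibre integral is the convolution in `p` of the constant `1` with `f (q, -·)`, evaluated at
  -- `0`, with `q` as parameter.
  have h := contDiffOn_convolution_right_with_param_comp (μ := (volume : Measure (Fin d → ℝ)))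
    (n := ⊤) (ContinuousLinearMap.mul ℝ ℝ) (s := (univ : Set (Fin d → ℝ)))
    (v := fun _ => (0 : Fin d → ℝ)) contDiffOn_const (f := fun _ => (1 : ℝ))
    (g := fun q p => f (q, -p)) isOpen_univ hk
    (fun q p _ hp => image_eq_zero_of_notMem_tsupport fun h => hp ⟨-p, ⟨_, h, rfl⟩, neg_neg p⟩)
    (locallyIntegrable_const 1)
    (hf.comp (contDiff_fst.prodMk contDiff_snd.neg)).contDiffOn
  simpa [convolution_def] using h

/-! ### The kinetic moments are covariant tensor fields -/

theorem contDiff_divq {η : OneForm d} (hη : ContDiff ℝ ∞ η) : ContDiff ℝ ∞ (divq η) := by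
  refine ContDiff.sum fun l _ => ?_
  exact ((hη.clm_apply contDiff_const).fderiv_right (m := ∞) (by simp)).clm_apply contDiff_const

theorem divq_eq_zero_of_notMem {η : OneForm d} {z : Phase d} (hz : z ∉ tsupport η) :
    divq η z = 0 := by
  refine Finset.sum_eq_zero fun l _ => ?_
  have h : (fun w => η w (0, Pi.single l 1)) =ᶠ[nhds z] fun _ => 0 :=
    (notMem_tsupport_iff_eventuallyEq.1 hz).mono fun w hw => by simp [hw]
  rw [h.fderiv_eq]
  simp

theorem contDiff_momentDensity {η : OneForm d} (hη : ContDiff ℝ ∞ η) (n : ℕ) (i : Fin n → Fin d) :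
    ContDiff ℝ ∞ fun z => momentDensity η n z i := by
  cases n with
  | zero => exact contDiff_divq hη
  | succ n =>
    refine (contDiff_thetaPow n (Fin.init i)).mul ?_
    refine (contDiff_const.mul (hη.clm_apply contDiff_const)).add ((contDiff_divq hη).mul ?_)
    fun_prop

theorem momentDensity_eq_zero_of_notMem {η : OneForm d} {z : Phase d} (hz : z ∉ tsupport η)
    (n : ℕ) (i : Fin n → Fin d) : momentDensity η n z i = 0 := by
  cases n <;> simp [momentDensity, vartheta, divq_eq_zero_of_notMem hz,
    image_eq_zero_of_notMem_tsupport hz]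

theorem IsMomentumForm.hasCompactSupport_momentDensity {η : OneForm d} (hη : IsMomentumForm Q η)
    (n : ℕ) (i : Fin n → Fin d) : HasCompactSupport fun z => momentDensity η n z i :=
  HasCompactSupport.intro hη.2.1 fun _ hz => momentDensity_eq_zero_of_notMem hz n i

theorem IsMomentumForm.integrable_momentDensity {η : OneForm d} (hη : IsMomentumForm Q η)
    (n : ℕ) (i : Fin n → Fin d) (q : Fin d → ℝ) :
    Integrable fun p : Fin d → ℝ => momentDensity η n (q, p) i :=
  integrable_slice (contDiff_momentDensity hη.1 n i).continuous
    (hη.hasCompactSupport_momentDensity n i) q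

theorem norm_single_le (l : Fin d) : ‖(Pi.single l 1 : Fin d → ℝ)‖ ≤ 1 := by
  rw [pi_norm_le_iff_of_nonneg zero_le_one]
  intro j
  rcases eq_or_ne j l with rfl | h <;> simp [*]

theorem norm_dq_le (l : Fin d) : ‖((Pi.single l 1, 0) : Phase d)‖ ≤ 1 := by
  simpa [Prod.norm_def] using norm_single_le l

theorem norm_dp_le (l : Fin d) : ‖((0, Pi.single l 1) : Phase d)‖ ≤ 1 := by
  simpa [Prod.norm_def] using norm_single_le l

theorem abs_symmetrize_le {n : ℕ} {T : (Fin n → Fin d) → ℝ} {C : ℝ} (h : ∀ i, |T i| ≤ C)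
    (i : Fin n → Fin d) : |symmetrize T i| ≤ C := by
  have hn : (0 : ℝ) < (n.factorial : ℕ) := by exact_mod_cast n.factorial_pos
  rw [symmetrize, abs_mul, abs_inv, abs_of_pos hn, inv_mul_le_iff₀ hn]
  calc |∑ τ : Equiv.Perm (Fin n), T (i ∘ τ)| ≤ ∑ τ : Equiv.Perm (Fin n), |T (i ∘ τ)| :=
        Finset.abs_sum_le_sum_abs _ _
    _ ≤ ∑ _τ : Equiv.Perm (Fin n), C := Finset.sum_le_sum fun τ _ => h (i ∘ τ)
    _ = (n.factorial : ℕ) * C := by simp [Fintype.card_perm]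

/-- On the support each momentum factor is at most `ρ`; the linear growth caused by the coefficient
`n` in `ϑ` is absorbed by `2 ^ n`. -/
theorem IsMomentumForm.exists_abs_momentDensity_le {η : OneForm d} (hη : IsMomentumForm Q η) :
    ∃ M ρ : ℝ, tsupport η ⊆ Metric.closedBall 0 ρ ∧
      ∀ n z i, |momentDensity η n z i| ≤ M * (2 * ρ) ^ n := by
  obtain ⟨r, hr⟩ := hη.2.1.isBounded.subset_closedBall (0 : Phase d)
  obtain ⟨M₁, hM₁⟩ := hη.1.continuous.bounded_above_of_compact_support hη.2.1
  obtain ⟨M₂, hM₂⟩ := (contDiff_divq hη.1).continuous.bounded_above_of_compact_support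
    (HasCompactSupport.intro hη.2.1 fun _ hz => divq_eq_zero_of_notMem hz)
  -- Having `1 ≤ ρ` allows the term without the extra momentum factor to be bounded by one with it.
  set ρ := max r 1
  set M := max M₁ M₂
  have hρ : 1 ≤ ρ := le_max_right _ _
  have hM : 0 ≤ M := (norm_nonneg _).trans ((hM₁ 0).trans (le_max_left _ _))
  have hb : tsupport η ⊆ Metric.closedBall 0 ρ :=
    hr.trans (Metric.closedBall_subset_closedBall (le_max_left _ _))
  refine ⟨M, ρ, hb, fun n z i => ?_⟩
  by_cases hz : z ∈ tsupport η
  swap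
  · rw [momentDensity_eq_zero_of_notMem hz, abs_zero]
    positivity
  have hp (l : Fin d) : |z.2 l| ≤ ρ :=
    (norm_le_pi_norm z.2 l).trans ((norm_snd_le z).trans (by simpa using hb hz))
  have hd : |divq η z| ≤ M := (hM₂ z).trans (le_max_right _ _)
  cases n with
  | zero => simpa [momentDensity] using hd
  | succ n =>
    have hq : |η z (Pi.single (i (Fin.last n)) 1, 0)| ≤ M :=
      ((η z).le_of_opNorm_le_of_le ((hM₁ z).trans (le_max_left _ _)) (norm_dq_le _)).trans
        (mul_one M).le
    have ht : |thetaPow n z (Fin.init i)| ≤ ρ ^ n := by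
      rw [thetaPow, Finset.abs_prod]
      exact (Finset.prod_le_prod (fun _ _ => abs_nonneg _) fun j _ => hp _).trans (by simp)
    have hv : |vartheta η (n + 1) z (i (Fin.last n))| ≤ (n + 1) * M + M * ρ := by
      refine (abs_add_le _ _).trans (add_le_add ?_ ?_)
      · rw [abs_mul, Nat.abs_cast]
        push_cast
        gcongr
      · rw [abs_mul]
        exact mul_le_mul hd (hp _) (abs_nonneg _) hM
    have h2 : ((n : ℝ) + 2) ≤ 2 ^ (n + 1) := by
      have : n + 2 ≤ 2 ^ (n + 1) := Nat.lt_two_pow_self (n := n + 1)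
      exact_mod_cast this
    calc |momentDensity η (n + 1) z i| ≤ ρ ^ n * ((n + 1) * M + M * ρ) := by
          rw [momentDensity, abs_mul]
          exact mul_le_mul ht hv (abs_nonneg _) (by positivity)
      _ ≤ ρ ^ n * ((n + 1) * M * ρ + M * ρ) := by
          have : (n + 1 : ℝ) * M ≤ (n + 1) * M * ρ := le_mul_of_one_le_right (by positivity) hρ
          gcongr
      _ = M * ρ ^ (n + 1) * (n + 2) := by ring
      _ ≤ M * ρ ^ (n + 1) * 2 ^ (n + 1) := by gcongr
      _ = M * (2 * ρ) ^ (n + 1) := by rw [mul_pow]; ring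

theorem isCovariant_kineticMoments {η : OneForm d} (hη : IsMomentumForm Q η) :
    IsCovariant Q (kineticMoments η) := by
  refine ⟨fun n => contDiff_pi.2 fun i => ?_, fun n q i τ => symmetrize_comp_perm _ i τ,
    ⟨Prod.fst '' tsupport η, IsCompact.image hη.2.1 continuous_fst, ?_, fun n q hq => ?_⟩, ?_⟩
  · exact contDiff_const.mul (ContDiff.sum fun τ _ => contDiff_integral_slice
      (contDiff_momentDensity hη.1 n _) (hη.hasCompactSupport_momentDensity n _))
  · rintro _ ⟨z, hz, rfl⟩
    exact mem_cotangent.1 (hη.2.2 hz)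
  · have h (i : Fin n → Fin d) (p : Fin d → ℝ) : momentDensity η n (q, p) i = 0 :=
      momentDensity_eq_zero_of_notMem (fun h => hq ⟨_, h, rfl⟩) n i
    ext i
    simp [kineticMoments, symmetrize, h]
  · obtain ⟨M, ρ, hs, hb⟩ := hη.exists_abs_momentDensity_le
    -- Integrating the uniform bound over the ball containing the momenta in the support costs its
    -- volume, independently of `n`.
    refine ⟨M * volume.real (Metric.closedBall (0 : Fin d → ℝ) ρ), 2 * ρ, fun n q i => ?_⟩
    refine abs_symmetrize_le (fun i => ?_) i
    rw [← setIntegral_eq_integral_of_forall_compl_eq_zero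
      (s := Metric.closedBall (0 : Fin d → ℝ) ρ) fun p hp => momentDensity_eq_zero_of_notMem
        (fun h => hp ?_) n i]
    · have h := norm_setIntegral_le_of_norm_le_const (μ := volume)
        (f := fun p : Fin d → ℝ => momentDensity η n (q, p) i)
        (s := Metric.closedBall (0 : Fin d → ℝ) ρ) measure_closedBall_lt_top
        fun p _ => hb n (q, p) i
      exact h.trans (le_of_eq (by ring))
    · have := hs h
      rw [mem_closedBall_zero_iff] at this ⊢
      exact (norm_snd_le (q, p)).trans this

/-! ### Linearity of the kinetic moments -/

theorem divq_add_smul {η ζ : OneForm d} (hη : ContDiff ℝ ∞ η) (hζ : ContDiff ℝ ∞ ζ) (c : ℝ)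
    (z : Phase d) : divq (η + c • ζ) z = divq η z + c * divq ζ z := by
  have h {ξ : OneForm d} (hξ : ContDiff ℝ ∞ ξ) (w : Phase d) :
      DifferentiableAt ℝ (fun y => ξ y w) z :=
    (hξ.clm_apply contDiff_const).differentiable (by simp) z
  simp only [divq, Finset.mul_sum, ← Finset.sum_add_distrib]
  refine Finset.sum_congr rfl fun l _ => ?_
  have e : (fun w => (η + c • ζ) w (0, Pi.single l 1)) =
      fun w => η w (0, Pi.single l 1) + c • ζ w (0, Pi.single l 1) := by ext; simp
  rw [e, fderiv_fun_add (h hη _) ((h hζ _).fun_const_smul c), fderiv_fun_const_smul (h hζ _)]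
  simp

theorem kineticMoments_add_smul {η ζ : OneForm d} (hη : IsMomentumForm Q η)
    (hζ : IsMomentumForm Q ζ) (c : ℝ) :
    kineticMoments (η + c • ζ) = kineticMoments η + c • kineticMoments ζ := by
  have h (n : ℕ) (z : Phase d) (i : Fin n → Fin d) : momentDensity (η + c • ζ) n z i =
      momentDensity η n z i + c * momentDensity ζ n z i := by
    cases n with
    | zero => exact divq_add_smul hη.1 hζ.1 c z
    | succ n =>
      simp only [momentDensity, vartheta, divq_add_smul hη.1 hζ.1, Pi.add_apply, Pi.smul_apply,
        add_apply, smul_apply, smul_eq_mul]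
      ring
  ext n q i
  simp only [kineticMoments, symmetrize, Pi.add_apply, Pi.smul_apply, smul_eq_mul]
  rw [mul_left_comm, ← mul_add, Finset.mul_sum _ _ c, ← Finset.sum_add_distrib]
  congr 1
  refine Finset.sum_congr rfl fun τ _ => ?_
  rw [← integral_const_mul, ← integral_add (hη.integrable_momentDensity n _ q)
    ((hζ.integrable_momentDensity n _ q).const_mul c)]
  simp only [h]

/-! ### Duality -/

/-- Adding the divergence `∇_q · (h Π_p)`, of zero integral, replaces `-Π_p · ∇_q h` by `(∇_q · Π_p)
h`. -/
theorem phasePairing_hamiltonianField (hQ : IsOpen Q) {η : OneForm d} (hη : IsMomentumForm Q η)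
    {h : Phase d → ℝ} (hh : ContDiffOn ℝ ∞ h (cotangent Q)) :
    phasePairing Q η (hamiltonianField h) = ∫ z in cotangent Q,
      (∑ l : Fin d, η z (Pi.single l 1, 0) * fderiv ℝ h z (0, Pi.single l 1) +
        divq η z * h z) := by
  have ho := isOpen_cotangent hQ
  have hd := hh.fderiv_of_isOpen (m := ∞) ho (by simp)
  have hηw (w : Phase d) : ContDiff ℝ ∞ fun z => η z w := hη.1.clm_apply contDiff_const
  have hsub (w : Phase d) : tsupport (fun z => η z w * h z) ⊆ tsupport η :=
    closure_mono fun z hz hz' => hz (by simp [hz'])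
  have hg (w : Phase d) : ContDiff ℝ ∞ fun z => η z w * h z :=
    contDiff_of_tsupport_subset ho ((hηw w).contDiffOn.mul hh) ((hsub w).trans hη.2.2)
  have hgc (w : Phase d) : HasCompactSupport fun z => η z w * h z :=
    hη.2.1.of_isClosed_subset (isClosed_tsupport _) (hsub w)
  have hi (v w : Phase d) : Integrable fun z => fderiv ℝ (fun y => η y w * h y) z v :=
    (((hg w).continuous_fderiv (by simp)).clm_apply
      continuous_const).integrable_of_hasCompactSupport ((hgc w).fderiv_apply ℝ v)
  have hz : ∫ z in cotangent Q, ∑ l : Fin d,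
      fderiv ℝ (fun y => η y (0, Pi.single l 1) * h y) z (Pi.single l 1, 0) = 0 := by
    rw [integral_finsetSum _ fun l _ => (hi _ _).integrableOn]
    refine Finset.sum_eq_zero fun l _ => ?_
    rw [setIntegral_eq_integral_of_forall_compl_eq_zero fun z hz => ?_,
      integral_fderiv_apply_eq_zero _ (hg _) (hgc _)]
    rw [image_eq_zero_of_notMem_tsupport fun h' =>
      hz (hη.2.2 (hsub _ (tsupport_fderiv_subset ℝ h')))]
    rfl
  rw [← add_zero (phasePairing _ _ _), ← hz, phasePairing, ← integral_add
    (hη.integrable hQ (contDiffOn_hamiltonianField hQ hh)).integrableOn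
    (integrable_finsetSum _ fun l _ => (hi _ _).integrableOn)]
  refine setIntegral_congr_fun ho.measurableSet fun z hz => ?_
  have hhz := ((hh.contDiffAt (ho.mem_nhds hz)).differentiableAt (by simp)).hasFDerivAt
  have e (w v : Phase d) : fderiv ℝ (fun y => η y w * h y) z v =
      η z w * fderiv ℝ h z v + h z * fderiv ℝ (fun y => η y w) z v := by
    rw [(((hηw w).differentiable (by simp) z).hasFDerivAt.fun_mul hhz).fderiv]
    simp
  simp only [e]
  rw [clm_apply_phase, divq, Finset.sum_mul, ← Finset.sum_add_distrib, ← Finset.sum_add_distrib]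
  refine Finset.sum_congr rfl fun l _ => ?_
  simp only [hamiltonianField]
  ring

/-- The reason for the form of `ϑ`: `n Π_q` matches the `p`-derivative of the degree `n`
Hamiltonian, and the factor `p` beside the divergence completes `θ^{n-1}` to `θ^n`. -/
theorem sum_momentDensity_mul {X : TensorFamily d} (hQ : IsOpen Q) (hX : IsContravariant Q X)
    (η : OneForm d) (n : ℕ) {z : Phase d} (hz : z.1 ∈ Q) :
    ∑ i, momentDensity η n z i * X n z.1 i =
      ∑ l : Fin d, η z (Pi.single l 1, 0) * fderiv ℝ (hamiltonian X n) z (0, Pi.single l 1) +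
        divq η z * hamiltonian X n z := by
  cases n with
  | zero =>
    simp [fderiv_hamiltonian_dp_zero hQ (hX.1 0) hz, hamiltonian, momentDensity, thetaPow]
  | succ n =>
    have e1 : ∑ i : Fin (n + 1) → Fin d, thetaPow n z (Fin.init i) *
        η z (Pi.single (i (Fin.last n)) 1, 0) * X (n + 1) z.1 i =
        ∑ l, η z (Pi.single l 1, 0) * ∑ i, thetaPow n z i *
          X (n + 1) z.1 (Fin.snoc (α := fun _ => Fin d) i l) := by
      rw [← (Fin.snocEquiv fun _ => Fin d).sum_comp, Fintype.sum_prod_type]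
      refine Finset.sum_congr rfl fun l _ => ?_
      rw [Finset.mul_sum]
      refine Finset.sum_congr rfl fun i _ => ?_
      simp [Fin.snocEquiv]
      ring
    have e2 (i : Fin (n + 1) → Fin d) :
        thetaPow n z (Fin.init i) * z.2 (i (Fin.last n)) = thetaPow (n + 1) z i := by
      simp [thetaPow, Fin.prod_univ_castSucc, Fin.init]
    simp only [fderiv_hamiltonian_dp_succ hQ (hX.1 _) hz (hX.2.1 _ _ hz)]
    simp only [mul_left_comm _ (((n + 1 : ℕ)) : ℝ)]
    rw [← Finset.mul_sum, ← e1, Finset.mul_sum, hamiltonian, Finset.mul_sum,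
      ← Finset.sum_add_distrib]
    refine Finset.sum_congr rfl fun i _ => ?_
    rw [← e2, momentDensity, vartheta]
    ring

theorem pairingTerm_kineticMoments {X : TensorFamily d} (hQ : IsOpen Q)
    (hX : IsContravariant Q X) {η : OneForm d} (hη : IsMomentumForm Q η) (n : ℕ) :
    pairingTerm Q (kineticMoments η) X n =
      phasePairing Q η (hamiltonianField (hamiltonian X n)) := by
  have ho := isOpen_cotangent hQ
  have hXn (i : Fin n → Fin d) : ContDiffOn ℝ ∞ (fun z : Phase d => X n z.1 i) (cotangent Q) :=
    (contDiffOn_pi.1 (hX.1 n) i).comp contDiff_fst.contDiffOn fun z hz => mem_cotangent.1 hz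
  have hint (i : Fin n → Fin d) :
      Integrable fun z : Phase d => momentDensity η n z i * X n z.1 i := by
    have hs : tsupport (fun z : Phase d => momentDensity η n z i * X n z.1 i) ⊆ tsupport η :=
      closure_minimal (fun z hz => by_contra fun h =>
        hz (by simp [momentDensity_eq_zero_of_notMem h])) (isClosed_tsupport η)
    exact (contDiff_of_tsupport_subset ho ((contDiff_momentDensity hη.1 n i).contDiffOn.mul
      (hXn i)) (hs.trans hη.2.2)).continuous.integrable_of_hasCompactSupport
      (hη.2.1.of_isClosed_subset (isClosed_tsupport _) hs)
  rw [phasePairing_hamiltonianField hQ hη (contDiffOn_hamiltonian (hX.1 n))]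
  rw [← setIntegral_congr_fun ho.measurableSet fun z hz =>
    sum_momentDensity_mul hQ hX η n (mem_cotangent.1 hz)]
  -- Fubini: `X^n` depends on `q` only, so the inner integral over `p` is that of the moment density
  -- alone.
  rw [cotangent, Measure.volume_eq_prod, setIntegral_prod _ (integrable_finsetSum _ fun i _ =>
    (hint i)).integrableOn]
  refine setIntegral_congr_fun hQ.measurableSet fun q hq => ?_
  simp only [setIntegral_univ]
  rw [integral_finsetSum _ fun i _ => (hη.integrable_momentDensity n i q).mul_const _]
  simp only [integral_mul_const, kineticMoments]
  simp only [mul_comm _ (X n q _)]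
  exact sum_mul_symmetrize (fun i τ => hX.2.1 n q hq i τ) _

theorem norm_hamiltonianField_le (h : Phase d → ℝ) (z : Phase d) :
    ‖hamiltonianField h z‖ ≤ ‖fderiv ℝ h z‖ := by
  refine norm_prod_le_iff.2 ⟨(pi_norm_le_iff_of_nonneg (norm_nonneg _)).2 fun l => ?_,
    (pi_norm_le_iff_of_nonneg (norm_nonneg _)).2 fun l => ?_⟩
  · exact (fderiv ℝ h z).unit_le_opNorm _ (norm_dp_le l)
  · rw [hamiltonianField, norm_neg]
    exact (fderiv ℝ h z).unit_le_opNorm _ (norm_dq_le l)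

theorem hasSum_pairingTerm_kineticMoments {X : TensorFamily d} (hQ : IsOpen Q)
    (hX : IsContravariant Q X) {η : OneForm d} (hη : IsMomentumForm Q η) :
    HasSum (pairingTerm Q (kineticMoments η) X) (phasePairing Q η (completeLift X)) := by
  have ho := isOpen_cotangent hQ
  -- The field involves first derivatives of the Hamiltonians, so order `1` on the support of `η`
  -- gives the dominating series `‖η‖ u_n`.
  obtain ⟨u, hu, hb⟩ := hX.2.2 _ hη.2.1 hη.2.2 1
  have e : pairingTerm Q (kineticMoments η) X = fun n =>
      ∫ z in cotangent Q, η z (hamiltonianField (hamiltonian X n) z) :=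
    funext fun n => pairingTerm_kineticMoments hQ hX hη n
  rw [e]
  refine hasSum_integral_of_dominated_convergence (fun n z => ‖η z‖ * u n) (fun n => ?_)
    (fun n => ?_) ?_ ?_ ?_
  · exact (hη.integrable hQ (contDiffOn_hamiltonianField hQ
      (contDiffOn_hamiltonian (hX.1 n)))).integrableOn.aestronglyMeasurable
  · refine Filter.Eventually.of_forall fun z => ?_
    by_cases hz : z ∈ tsupport η
    · refine (η z).le_opNorm_of_le ((norm_hamiltonianField_le _ _).trans ?_)
      rw [← norm_iteratedFDeriv_one]
      exact hb n z hz
    · simp [image_eq_zero_of_notMem_tsupport hz]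
  · exact Filter.Eventually.of_forall fun z => hu.mul_left _
  · simp only [tsum_mul_left]
    exact ((hη.1.continuous.norm.integrable_of_hasCompactSupport
      hη.2.1.norm).mul_const _).integrableOn
  · refine (ae_restrict_iff' ho.measurableSet).2 (Filter.Eventually.of_forall fun z hz => ?_)
    rw [hX.completeLift_eq hQ hz]
    exact (hX.hasSum_hamiltonianField hQ hz).mapL (η z)

theorem tensorPairing_kineticMoments {X : TensorFamily d} (hQ : IsOpen Q)
    (hX : IsContravariant Q X) {η : OneForm d} (hη : IsMomentumForm Q η) :
    tensorPairing Q (kineticMoments η) X = phasePairing Q η (completeLift X) :=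
  (hasSum_pairingTerm_kineticMoments hQ hX hη).tsum_eq

/-! ### Tensor fields of a single order separate covariant tensor fields -/

/-- The family whose only nonzero member is `B`, of order `n`. -/
noncomputable def ofOrder (n : ℕ) (B : (Fin d → ℝ) → (Fin n → Fin d) → ℝ) : TensorFamily d :=
  Pi.single (M := fun n => (Fin d → ℝ) → (Fin n → Fin d) → ℝ) n B

theorem isContravariant_ofOrder (hQ : IsOpen Q) {n : ℕ}
    {B : (Fin d → ℝ) → (Fin n → Fin d) → ℝ} (hB : ContDiffOn ℝ ∞ B Q)
    (hs : ∀ q ∈ Q, ∀ (i : Fin n → Fin d) (τ : Equiv.Perm (Fin n)), B q (i ∘ τ) = B q i) :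
    IsContravariant Q (ofOrder n B) := by
  have ho := isOpen_cotangent hQ
  have hn : ofOrder n B n = B := Pi.single_eq_same _ _
  have hm {m : ℕ} (h : m ≠ n) : ofOrder n B m = 0 := Pi.single_eq_of_ne h _
  refine ⟨fun m => ?_, fun m => ?_, fun K hK hKs k => ?_⟩
  · rcases eq_or_ne m n with rfl | h
    · rwa [hn]
    · rw [hm h]; exact contDiffOn_const
  · rcases eq_or_ne m n with rfl | h
    · rwa [hn]
    · simp [hm h]
  · have hc : ContinuousOn (iteratedFDeriv ℝ k (hamiltonian (ofOrder n B) n)) K := by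
      have h : ContDiffOn ℝ ∞ (hamiltonian (ofOrder n B) n) (cotangent Q) :=
        contDiffOn_hamiltonian (by rwa [hn])
      refine ((h.continuousOn_iteratedFDerivWithin (m := k) (mod_cast le_top)
        ho.uniqueDiffOn).congr fun z hz => ?_).mono hKs
      exact (iteratedFDerivWithin_of_isOpen k ho hz).symm
    obtain ⟨C, hC⟩ := hK.exists_bound_of_continuousOn hc
    -- Only order `n` contributes, and there the derivative is continuous on the compact set, hence
    -- bounded by `C`.
    refine ⟨Pi.single n C, summable_of_hasFiniteSupport
      ((finite_singleton n).subset (Pi.support_single_subset)), fun m z hz => ?_⟩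
    rcases eq_or_ne m n with rfl | h
    · simpa using hC z hz
    · have : hamiltonian (ofOrder n B) m = 0 := by
        ext y; simp [hamiltonian, hm h]
      simp [this, h]

theorem tensorPairing_ofOrder (A : TensorFamily d) (n : ℕ)
    (B : (Fin d → ℝ) → (Fin n → Fin d) → ℝ) :
    tensorPairing Q A (ofOrder n B) = ∫ q in Q, ∑ i, A n q i * B q i := by
  rw [tensorPairing, tsum_eq_single n fun m h => ?_]
  · rw [pairingTerm, ofOrder, Pi.single_eq_same]
  · simp [pairingTerm, ofOrder, Pi.single_eq_of_ne h]

/-- Read in components, `A_n - A'_n` is itself an admissible contravariant field of order `n`;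
pairing with it shows that the integral of its squared components vanishes. -/
theorem IsCovariant.eq_of_tensorPairing_eq (hQ : IsOpen Q) {A A' : TensorFamily d}
    (hA : IsCovariant Q A) (hA' : IsCovariant Q A')
    (h : ∀ X, IsContravariant Q X → tensorPairing Q A X = tensorPairing Q A' X) : A = A' := by
  obtain ⟨K, hK, hKQ, hKA⟩ := hA.2.2.1
  obtain ⟨K', hK', hKQ', hKA'⟩ := hA'.2.2.1
  ext1 n
  have hX := isContravariant_ofOrder hQ (n := n) (B := A n - A' n)
    ((hA.1 n).sub (hA'.1 n)).contDiffOn fun q _ i τ => by simp [hA.2.1, hA'.2.1]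
  have hi {C : TensorFamily d} (hC : IsCovariant Q C) :
      Integrable fun q => ∑ i, C n q i * (A n - A' n) q i := by
    obtain ⟨L, hL, -, hLC⟩ := hC.2.2.1
    refine Continuous.integrable_of_hasCompactSupport ?_
      (HasCompactSupport.intro hL fun q hq => by simp [hLC n q hq])
    exact continuous_finsetSum _ fun i _ =>
      ((continuous_apply i).comp (hC.1 n).continuous).mul
        ((continuous_apply i).comp ((hA.1 n).continuous.sub (hA'.1 n).continuous))
  have h0 := h _ hX
  rw [tensorPairing_ofOrder, tensorPairing_ofOrder, ← sub_eq_zero,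
    ← integral_sub (hi hA).integrableOn (hi hA').integrableOn,
    setIntegral_eq_integral_of_forall_compl_eq_zero fun q hq => by
      simp [hKA n q fun h => hq (hKQ h), hKA' n q fun h => hq (hKQ' h)]] at h0
  have e : (fun q => ∑ i, A n q i * (A n - A' n) q i - ∑ i, A' n q i * (A n - A' n) q i) =
      fun q => ∑ i, (A n q i - A' n q i) ^ 2 := by
    ext q
    rw [← Finset.sum_sub_distrib]
    exact Finset.sum_congr rfl fun i _ => by simp; ring
  have hint := (hi hA).sub (hi hA')
  have hint' : Integrable fun q => ∑ i, (A n q i - A' n q i) ^ 2 := by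
    rw [← e]; exact hint
  simp only [e] at h0
  rw [integral_eq_zero_iff_of_nonneg (fun q => Finset.sum_nonneg fun i _ => sq_nonneg _) hint']
    at h0
  have hcont : Continuous fun q => ∑ i, (A n q i - A' n q i) ^ 2 :=
    continuous_finsetSum _ fun i _ => (((continuous_apply i).comp (hA.1 n).continuous).sub
      ((continuous_apply i).comp (hA'.1 n).continuous)).pow 2
  have h1 := (hcont.ae_eq_iff_eq volume continuous_zero).1 h0
  ext q i
  have h2 := congrFun h1 q
  rw [Pi.zero_apply, Finset.sum_eq_zero_iff_of_nonneg fun i _ => sq_nonneg _] at h2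
  exact sub_eq_zero.1 (pow_eq_zero_iff two_ne_zero |>.1 (h2 i (Finset.mem_univ i)))

/-! ### Duality, momentum map and Poisson map -/

theorem isDualMap_kineticMoments (hQ : IsOpen Q) : IsDualMap Q (kineticMoments (d := d)) := by
  intro η hη
  have hu (A : TensorFamily d) (hA : IsCovariant Q A)
      (h : ∀ X, IsContravariant Q X → tensorPairing Q A X = phasePairing Q η (completeLift X)) :
      A = kineticMoments η :=
    hA.eq_of_tensorPairing_eq hQ (isCovariant_kineticMoments hη) fun X hX =>
      (h X hX).trans (tensorPairing_kineticMoments hQ hX hη).symm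
  refine ⟨isCovariant_kineticMoments hη, fun X hX => ⟨hX.isHamiltonianField hQ,
    hasSum_pairingTerm_kineticMoments hQ hX hη⟩, hu, fun k hk hc hs => ?_⟩
  have hm := isMomentumForm_fderiv hk hc hs
  -- Exact forms pair to zero with Hamiltonian fields, so the moments of `η + dk` have the property
  -- that characterizes those of `η`.
  refine hu _ (isCovariant_kineticMoments (hη.add hm)) fun X hX => ?_
  have hX' := hX.isHamiltonianField hQ
  have h := phasePairing_add_smul hQ hη hm (hX'.contDiffOn hQ) 1
  rw [one_smul, phasePairing_fderiv_hamiltonianField hQ hk hc hs hX', mul_zero, add_zero] at h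
  rw [tensorPairing_kineticMoments hQ hX (hη.add hm), h]

theorem infinitesimalAction_schouten (hQ : IsOpen Q) (σ : ℤˣ) {X Y : TensorFamily d}
    {η : OneForm d} (hX : IsContravariant Q X) (hY : IsContravariant Q Y)
    (hη : IsMomentumForm Q η) :
    infinitesimalAction σ (sgn σ • schouten X Y) η =
      infinitesimalAction σ X (infinitesimalAction σ Y η) -
        infinitesimalAction σ Y (infinitesimalAction σ X η) := by
  have ho := isOpen_cotangent hQ
  have hU := (hX.isHamiltonianField hQ).contDiffOn hQ
  have hV := (hY.isHamiltonianField hQ).contDiffOn hQ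
  -- On the left one `σ` comes from the action and one from the bracket, on the right one from each
  -- action; both products are `1`.
  simp only [infinitesimalAction, completeLift_smul, lieDerivative_smul, lieDerivative_smul_left,
    smul_smul, sgn_mul_self, one_smul]
  ext1 z
  rw [Pi.sub_apply]
  by_cases hz : z ∈ tsupport η
  · have hn := ho.mem_nhds (hη.2.2 hz)
    rw [← lieDerivative_lieBracket (hU.contDiffAt hn) (hV.contDiffAt hn) hη.1.contDiffAt]
    have e : completeLift (schouten X Y) =ᶠ[nhds z]
        VectorField.lieBracket ℝ (completeLift X) (completeLift Y) :=
      Filter.eventuallyEq_of_mem hn fun y hy => completeLift_schouten hQ hX hY hy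
    rw [lieDerivative, lieDerivative, e.fderiv_eq, e.eq_of_nhds]
  · have hs (U : Phase d → Phase d) : z ∉ tsupport (lieDerivative U η) := fun h => hz
      (closure_minimal (fun y (hy : lieDerivative U η y ≠ 0) => by_contra fun h' =>
        hy (lieDerivative_eq_zero_of_notMem h')) (isClosed_tsupport η) h)
    simp [lieDerivative_eq_zero_of_notMem hz, lieDerivative_eq_zero_of_notMem (hs _)]

/-- Pulling back along the kinetic moments turns functional derivatives in `𝔗Q` into their
complete cotangent lifts. -/
theorem IsTensorDerivative.comp_kineticMoments (hQ : IsOpen Q) {F : TensorFamily d → ℝ}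
    {η : OneForm d} (hη : IsMomentumForm Q η) {X : TensorFamily d}
    (hX : IsTensorDerivative Q F (kineticMoments η) X) :
    IsPhaseDerivative Q (F ∘ kineticMoments) η (completeLift X) := by
  refine ⟨hX.1.isHamiltonianField hQ, fun ζ hζ => ?_⟩
  have h := hX.2 _ (isCovariant_kineticMoments hζ)
  rw [tensorPairing_kineticMoments hQ hX.1 hζ] at h
  simpa only [Function.comp_apply, kineticMoments_add_smul hη hζ] using h

theorem isPhaseDerivative_tensorPairing (hQ : IsOpen Q) {X : TensorFamily d}
    (hX : IsContravariant Q X) {η : OneForm d} (hη : IsMomentumForm Q η) :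
    IsPhaseDerivative Q (fun ζ => tensorPairing Q (kineticMoments ζ) X) η (completeLift X) := by
  have hX' := hX.isHamiltonianField hQ
  refine ⟨hX', fun ζ hζ => ?_⟩
  have e (ε : ℝ) : tensorPairing Q (kineticMoments (η + ε • ζ)) X =
      phasePairing Q η (completeLift X) + ε * phasePairing Q ζ (completeLift X) := by
    rw [tensorPairing_kineticMoments hQ hX (hη.add (hζ.smul ε)),
      phasePairing_add_smul hQ hη hζ (hX'.contDiffOn hQ)]
  simp only [e]
  simpa using ((hasDerivAt_id (0 : ℝ)).mul_const (phasePairing Q ζ (completeLift X))).const_add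
    (phasePairing Q η (completeLift X))

theorem isMomentumMap_kineticMoments (hQ : IsOpen Q) (σ : ℤˣ) :
    IsMomentumMap Q σ (kineticMoments (d := d)) := by
  have hm (X : TensorFamily d) (η : OneForm d) (hX : IsContravariant Q X)
      (hη : IsMomentumForm Q η) : IsMomentumForm Q (infinitesimalAction σ X η) :=
    (hη.lieDerivative hQ ((hX.isHamiltonianField hQ).contDiffOn hQ)).smul _
  refine ⟨hm, fun X Y η hX hY hη => ⟨hX.schouten hQ hY,
    infinitesimalAction_schouten hQ σ hX hY hη⟩, fun X η hX hη =>
    ⟨isPhaseDerivative_tensorPairing hQ hX hη, fun K ⟨U, hU⟩ => ?_⟩⟩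
  -- The bracket with `J_X` becomes the pairing of `σ L_{X^{c*}} η` with `δK/δη`, which is the
  -- derivative of `K` along the generator.
  rw [liePoisson_eq hQ σ hU (isPhaseDerivative_tensorPairing hQ hX hη),
    ← phasePairing_lieDerivative hQ hη (hU.1.contDiffOn hQ) (hX.isHamiltonianField hQ),
    ← phasePairing_smul]
  exact hU.2 _ (hm X η hX hη)

theorem isPoissonMap_kineticMoments (hQ : IsOpen Q) (σ : ℤˣ) :
    IsPoissonMap Q σ (kineticMoments (d := d)) := by
  intro η hη F G hF hG
  have hX : IsTensorDerivative Q F _ (tensorDerivative Q F (kineticMoments η)) :=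
    Classical.epsilon_spec hF
  have hY : IsTensorDerivative Q G _ (tensorDerivative Q G (kineticMoments η)) :=
    Classical.epsilon_spec hG
  have hU := hX.comp_kineticMoments hQ hη
  have hV := hY.comp_kineticMoments hQ hη
  refine ⟨⟨_, hU⟩, ⟨_, hV⟩, ?_⟩
  rw [liePoisson_eq hQ σ hU hV, kuperschmidtManin,
    tensorPairing_kineticMoments hQ (hX.1.schouten hQ hY.1) hη]
  congr 1
  exact phasePairing_congr hQ fun z hz => by rw [completeLift_schouten hQ hX.1 hY.1 hz]

end KineticMoments


theorem mainTheorem8 (d : ℕ) (Q : Set (Fin d → ℝ)) (hQ : IsOpen Q) :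
    IsDualMap Q (kineticMoments (d := d)) ∧
    ∀ σ : ℤˣ, IsMomentumMap Q σ (kineticMoments (d := d)) ∧
      IsPoissonMap Q σ (kineticMoments (d := d)) :=
  ⟨isDualMap_kineticMoments hQ, fun σ =>
    ⟨isMomentumMap_kineticMoments hQ σ, isPoissonMap_kineticMoments hQ σ⟩⟩
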